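/- Let $G$ be a locally compact (Hausdorff) Abelian group with Haar measure $\mu_G$, let $\hat G$ be its dual group of continuous characters $\xi:G\to\mathbb R/\mathbb Z$ (with identity $0$, the compact-open topology and a Haar measure $\mu_{\hat G}$; Haar measures are Radon), and write $\hat u(\xi)=\int_G u(g)e^{-2\pi i\xi(g)}\,d\mu_G(g)$ for integrable $u:G\to\mathbb C^J$. For $s\ge 0$ and a measurable function $\gamma:\hat G\to[0,\infty)$ measuring the size of a frequency ($\gamma(\xi)=|\xi|$ on $\mathbb R^n$), let $H^{-s}(G;\mathbb C^I)$ be the Sobolev space whose elements have Fourier transforms $f:\hat G\to\mathbb C^I$ with $\int_{\hat G}(1+\gamma(\xi)^2)^{-s}|f(\xi)|^2\,d\mu_{\hat G}(\xi)<\infty$. Let $\mathcal T:L^2(G;\mathbb C^J)\to H^{-s}(G;\mathbb C^I)$ be a (bounded) Fourier multiplier operator with multiplier $m:\hat G\to\mathrm{Mat}(I\times J;\mathbb C)$, that is, $\widehat{\mathcal Tu}=m\,\hat u$ almost everywhere for all $u\in L^1\cap L^2$. Let $Q(\lambda)=\sum_{j,k=1}^J Q_{jk}\lambda^j\overline{\lambda^k}$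 with $Q_{jk}=\overline{Q_{kj}}\in\mathbb C$, and let $\{u_\varepsilon\}$ be a sequence in $L^2(G;\mathbb C^J)$. Assume that (i) $u_\varepsilon\rightharpoonup u$ weakly in $L^2_c(G;\mathbb C^J)$: there is a compact set $K\subset G$ such that every $u_\varepsilon$ vanishes almost everywhere outside $K$, and $u_\varepsilon\rightharpoonup u$ weakly in $L^2(G;\mathbb C^J)$. (ii) There exist a compact set $\Xi\subset\hat G$ containing $0$, a compact set $\mathcal K\subset\hat G\setminus\{0\}$ on which $m$ is continuous (that is, $m|_{\mathcal K}$ is continuous), and a continuous surjective map $\Phi:\hat G\setminus\Xi\to\mathcal K$ such that, with $(\Phi^*m)(\xi):=m(\Phi(\xi))$, the sequence $\{(\Phi^*m)\,\hat u_\varepsilon\}$ is precompact in $L^2(\hat G\setminus\Xi;\mathbb C^I)$. (iii) $Q(\lambda)=0$ for every $\lambda$ in the cone $\Lambda_{\mathcal T}:=\{\lambda\in\mathbb C^J:\ m(\xi)\lambda=0\text{ for some }\xi\in\hat G\setminus\{0\}\}$. Then $$\lim_{\varepsilon\to0}\int_G Q(u_\varepsilon(g))\,d\mu_G(g)=\int_G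 Q(u(g))\,d\mu_G(g).$$ -/

import Mathlib

open MeasureTheory Filter Topology
open scoped NNReal ENNReal Matrix

noncomputable section

namespace LCA

/-- The space `L²(X; ℂ^J)`, where `ℂ^J` carries its Euclidean norm. -/
abbrev L2 {X : Type*} [MeasurableSpace X] (μ : Measure X) (J : ℕ) : Type _ :=
  Lp (EuclideanSpace ℂ (Fin J)) 2 μ

/-- The Fourier transform `û(ξ) = ∫ u(g) conj (ξ g) dμ(g)` of a vector-valued function on `G`.
Characters are written multiplicatively: `ξ g` here is `e^{2πi ξ(g)}` for the corresponding
additive character with values in `ℝ/ℤ`. It is meaningful for integrable `u`. -/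
def fourier {G : Type*} [CommGroup G] [TopologicalSpace G] [MeasurableSpace G]
    (μ : Measure G) {J : ℕ} (u : G → EuclideanSpace ℂ (Fin J)) (ξ : PontryaginDual G) :
    EuclideanSpace ℂ (Fin J) :=
  ∫ g, (starRingEnd ℂ) (ξ g : ℂ) • u g ∂μ

/-- Weak convergence of a sequence in `L²_c(G; ℂ^J)`, the union over the compact sets `K` of the
spaces of square integrable functions that vanish outside `K`, with its inductive limit topology:
the functions vanish almost everywhere outside one compact set, and converge weakly in `L²`. -/
def WeaklyConvergesL2c {G : Type*} [TopologicalSpace G] [MeasurableSpace G]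
    (μ : Measure G) {J : ℕ} (u : ℕ → L2 μ J) (u₀ : L2 μ J) : Prop :=
  (∃ K : Set G, IsCompact K ∧ ∀ n, ∀ᵐ g ∂μ, g ∉ K → u n g = 0) ∧
    ∀ φ : L2 μ J, Tendsto (fun n => inner ℂ φ (u n)) atTop (𝓝 (inner ℂ φ u₀))

/-- The Sobolev space `H^{-s}(G; ℂ^I)`, realized by Fourier transforms: its elements are the
(classes of) functions `f` on the dual group with `∫ (1 + γ(ξ)²)^{-s} |f(ξ)|² dν(ξ) < ∞`.
The function `γ` measures the size of a frequency; on `ℝⁿ` it is `γ(ξ) = |ξ|`. -/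
abbrev HNeg {X : Type*} [MeasurableSpace X] (ν : Measure X) (γ : X → ℝ≥0) (s : ℝ) (I : ℕ) :
    Type _ :=
  L2 (ν.withDensity fun ξ => ENNReal.ofReal ((1 + (γ ξ : ℝ) ^ 2) ^ (-s))) I

/-- `T : L²(G; ℂ^J) → H^{-s}(G; ℂ^I)` is the Fourier multiplier operator with multiplier `m`: the
Fourier transform of `T u` is `m û`. The identity is required for `u ∈ L¹ ∩ L²`, where `û` is given
by the integral; this determines `T` as `L¹ ∩ L²` is dense in `L²`. -/
def IsMultiplier {G : Type*} [CommGroup G] [TopologicalSpace G] [MeasurableSpace G]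
    [MeasurableSpace (PontryaginDual G)] (μ : Measure G) (ν : Measure (PontryaginDual G))
    {I J : ℕ} {γ : PontryaginDual G → ℝ≥0} {s : ℝ} (T : L2 μ J →L[ℂ] HNeg ν γ s I)
    (m : PontryaginDual G → Matrix (Fin I) (Fin J) ℂ) : Prop :=
  ∀ u : L2 μ J, Integrable (u : G → EuclideanSpace ℂ (Fin J)) μ →
    (T u : PontryaginDual G → EuclideanSpace ℂ (Fin I)) =ᵐ[ν]
      fun ξ => Matrix.toEuclideanLin (m ξ) (fourier μ u ξ)

/-- The sequence of functions `F n` lies in `L²(X; ℂ^I)` and is precompact (has compact closure)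
there. -/
def PrecompactInL2 {X : Type*} [MeasurableSpace X] (ν : Measure X) {I : ℕ}
    (F : ℕ → X → EuclideanSpace ℂ (Fin I)) : Prop :=
  ∃ hF : ∀ n, MemLp (F n) 2 ν,
    IsCompact (closure (Set.range fun n => ((hF n).toLp (F n) : L2 ν I)))

/-- The quadratic polynomial `Q(λ) = ∑ⱼₖ Qⱼₖ λʲ conj(λᵏ)` of a complex matrix. -/
def quadForm {J : ℕ} (Q : Matrix (Fin J) (Fin J) ℂ) (v : EuclideanSpace ℂ (Fin J)) : ℂ :=
  ∑ j, ∑ k, Q j k * v j * (starRingEnd ℂ) (v k)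

/-- The cone of a multiplier: the vectors annihilated by `m ξ` for some nontrivial character `ξ`
(the trivial character, `0` in additive notation, is `1` here). -/
def cone {G : Type*} [CommGroup G] [TopologicalSpace G] {I J : ℕ}
    (m : PontryaginDual G → Matrix (Fin I) (Fin J) ℂ) : Set (EuclideanSpace ℂ (Fin J)) :=
  {v | ∃ ξ : PontryaginDual G, ξ ≠ 1 ∧ Matrix.toEuclideanLin (m ξ) v = 0}

end LCA

end

/-!
Write `v n = u n - u₀`, which tends weakly to zero with supports in one compact set. By Parseval's
formula `∫ Q(v n) dμ` is a constant multiple of `∫ Q(v̂ n) dν`, and this integral is split along `Ξ`.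

* On `Ξ`, a set of finite measure, `v̂ n` is uniformly bounded and tends to zero pointwise, since
  `v̂ n ξ` is the pairing of `v n` with a character cut off to the compact support. Dominated
  convergence applies.
* Off `Ξ` the functions `m(Φ ξ) (û n ξ)` are precompact in `L²` and converge pointwise, hence converge
  in `L²` (`PrecompactInL2.tendsto_eLpNorm`), so that `m(Φ ξ) (v̂ n ξ)` tends to zero in `L²`. As `Q`
  vanishes on the kernels of the matrices `m ξ`, `ξ ∈ 𝒦`, compactness of `𝒦` and of the unit sphere
  gives `|Q(λ)| ≤ δ |λ|² + C_δ |m(ξ) λ|²` for all `δ > 0` (`exists_norm_quadForm_le`), and `v̂ n` is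
  bounded in `L²`.

So `∫ Q(v n) dμ → 0`. Since `∫ Q(u) dμ = ⟪u, A u⟫` for a bounded operator `A` on `L²`, the cross terms
of `u n = v n + u₀` vanish in the limit by weak convergence (`tendsto_inner_apply_of_sub`).

Most of the file is the Plancherel theorem for a locally compact abelian group, for functions in `L²`
with compact support and Haar measures that are Radon but need not be `σ`-finite. For a unitary
representation `π` on `H`, the bicommutant of `π` is a commutative C⋆-algebra. A character of it that
does not vanish on all operators `π(f) = ∫ f(x) π(x) dx` determines a point `ξ` of the dual group, and
its value at `π(f)` is `f̂(ξ)` (`UnitaryRep.character_integratedB`). Through the Gelfand transform,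
compactly supported functions `φ` on the dual group act on `H`, and each vector `v` has a spectral
functional `φ ↦ ⟪v, φ(π) v⟫` of total mass `‖v‖²` (`UnitaryRep.spectral_le`,
`UnitaryRep.exists_sub_le_spectral`); for `π(f) v` it is that of `v` times `|f̂|²`
(`UnitaryRep.spectral_integrated`).

In the regular representation write `M_f` for the spectral measure of `f ∈ C_c(G)`. Commutativity of
convolution gives `|f̂|² M_g = |ĝ|² M_f`, and multiplication of `f` by a character translates both
`f̂` and `M_f`. Integrating the relation over all these translates yields
`M_g(φ) ∫ ψ |f̂|² dν = M_f(ψ) ∫ φ |ĝ|² dν` (`spectralCc_mul_integral`), so `M_g = c |ĝ|² ν` with one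
constant `c > 0`. Comparing total masses is the Plancherel theorem on `C_c(G)`
(`exists_eLpNorm_scalarFourier_compactlySupported`); density and polarization give
`integral_scalarFourier_mul_conj`.
-/

set_option linter.unusedSectionVars false

noncomputable section

namespace LCA

open scoped CompactlySupported ComplexConjugate

/-! ### Unitary representations of a locally compact group -/

section

/-- A strongly continuous unitary representation of a topological group on a Hilbert space. -/
structure UnitaryRep (G H : Type*) [Group G] [TopologicalSpace G] [NormedAddCommGroup H]
    [InnerProductSpace ℂ H] [CompleteSpace H] where
  /-- The underlying homomorphism into the unitary group of `H`. -/
  toHom : G →* unitary (H →L[ℂ] H)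
  continuous_apply : ∀ v, Continuous fun x => (toHom x : H →L[ℂ] H) v

namespace UnitaryRep

section Integrated

variable {G H : Type*} [CommGroup G] [TopologicalSpace G] [IsTopologicalGroup G]
  [NormedAddCommGroup H] [InnerProductSpace ℂ H] [CompleteSpace H] (π : UnitaryRep G H)

/-- The bounded operator by which a group element acts. -/
def op (x : G) : H →L[ℂ] H := (π.toHom x : H →L[ℂ] H)

lemma op_mul (x y : G) : π.op (x * y) = π.op x * π.op y := by
  simp [op]

lemma op_one : π.op 1 = 1 := by
  simp [op]

lemma star_op (x : G) : star (π.op x) = π.op x⁻¹ := by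
  rw [op, op, map_inv]
  rfl

lemma star_op_mul_op (x : G) : star (π.op x) * π.op x = 1 := by
  rw [star_op, ← op_mul, inv_mul_cancel, op_one]

lemma continuous_op_apply (v : H) : Continuous fun x => π.op x v := π.continuous_apply v

lemma norm_op_apply (x : G) (v : H) : ‖π.op x v‖ = ‖v‖ :=
  ContinuousLinearMap.norm_map_of_mem_unitary (π.toHom x).2 v

variable [MeasurableSpace G] [BorelSpace G] (μ : Measure G) [μ.IsHaarMeasure]

lemma integrable_smul_op (f : C_c(G, ℂ)) (v : H) : Integrable (fun x => f x • π.op x v) μ :=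
  (f.continuous.smul (π.continuous_op_apply v)).integrable_of_hasCompactSupport
    f.hasCompactSupport.smul_right

lemma integrable_compactlySupported (f : C_c(G, ℂ)) : Integrable f μ :=
  f.continuous.integrable_of_hasCompactSupport f.hasCompactSupport

lemma norm_integral_smul_op_le (f : C_c(G, ℂ)) (v : H) :
    ‖∫ x, f x • π.op x v ∂μ‖ ≤ (∫ x, ‖f x‖ ∂μ) * ‖v‖ := by
  refine (norm_integral_le_integral_norm _).trans (le_of_eq ?_)
  simp_rw [norm_smul, norm_op_apply, integral_mul_const]

/-- The integrated form `∫ f(x) π(x) dx` of a unitary representation, as an operator. -/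
def integrated (f : C_c(G, ℂ)) : H →L[ℂ] H :=
  LinearMap.mkContinuous
    { toFun := fun v => ∫ x, f x • π.op x v ∂μ
      map_add' := fun v w => by
        simp_rw [map_add, smul_add]
        exact integral_add (π.integrable_smul_op μ f v) (π.integrable_smul_op μ f w)
      map_smul' := fun c v => by
        simp_rw [map_smul, smul_comm _ c, integral_smul]
        rfl }
    (∫ x, ‖f x‖ ∂μ) (π.norm_integral_smul_op_le μ f)

lemma integrated_apply (f : C_c(G, ℂ)) (v : H) :
    π.integrated μ f v = ∫ x, f x • π.op x v ∂μ := rfl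

lemma norm_integrated_le (f : C_c(G, ℂ)) : ‖π.integrated μ f‖ ≤ ∫ x, ‖f x‖ ∂μ :=
  LinearMap.mkContinuous_norm_le _ (integral_nonneg fun _ => norm_nonneg _) _

lemma integrated_sub (f g : C_c(G, ℂ)) :
    π.integrated μ (f - g) = π.integrated μ f - π.integrated μ g := by
  ext v
  simp only [integrated_apply, _root_.sub_apply, CompactlySupportedContinuousMap.coe_sub,
    Pi.sub_apply, sub_smul]
  exact integral_sub (π.integrable_smul_op μ f v) (π.integrable_smul_op μ g v)

/-- Operators commuting with a representation commute with its integrated form. -/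
lemma commute_integrated (f : C_c(G, ℂ)) {b : H →L[ℂ] H} (hb : ∀ x, b * π.op x = π.op x * b) :
    b * π.integrated μ f = π.integrated μ f * b := by
  ext v
  simp only [mul_apply_eq_comp, integrated_apply]
  rw [← ContinuousLinearMap.integral_comp_comm _ (π.integrable_smul_op μ f v)]
  refine integral_congr_ae (Eventually.of_forall fun x => ?_)
  have := congrArg (fun T : H →L[ℂ] H => T v) (hb x)
  simp only [mul_apply_eq_comp] at this
  simp [this]

/-- The left translate `y ↦ f (x⁻¹ y)` of a compactly supported continuous function. -/
def translate (x : G) (f : C_c(G, ℂ)) : C_c(G, ℂ) where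
  toFun y := f (x⁻¹ * y)
  continuous_toFun := f.continuous.comp (continuous_const_mul _)
  hasCompactSupport' := f.hasCompactSupport.comp_homeomorph (Homeomorph.mulLeft x⁻¹)

lemma translate_apply (x y : G) (f : C_c(G, ℂ)) : translate x f y = f (x⁻¹ * y) := rfl

lemma op_mul_integrated (x : G) (f : C_c(G, ℂ)) :
    π.op x * π.integrated μ f = π.integrated μ (translate x f) := by
  ext v
  simp only [mul_apply_eq_comp, integrated_apply]
  rw [← ContinuousLinearMap.integral_comp_comm _ (π.integrable_smul_op μ f v),
    ← integral_mul_left_eq_self _ x⁻¹]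
  refine integral_congr_ae (Eventually.of_forall fun y => ?_)
  simp only [translate_apply, map_smul]
  rw [← mul_apply_eq_comp, ← op_mul, mul_inv_cancel_left]

/-- If `x ↦ π(x) b` is norm continuous, then `π(f) b` is an integral in operator norm. -/
lemma integrated_mul_apply (f : C_c(G, ℂ)) (b : H →L[ℂ] H) (hb : Continuous fun x => π.op x * b) :
    π.integrated μ f * b = ∫ x, f x • (π.op x * b) ∂μ := by
  ext v
  rw [ContinuousLinearMap.integral_apply, mul_apply_eq_comp, integrated_apply]
  · rfl
  · exact (f.continuous.smul hb).integrable_of_hasCompactSupport f.hasCompactSupport.smul_right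

section Regular

variable [T2Space G] [LocallyCompactSpace G] [μ.Regular]

/-- Translation is continuous in `L¹`, so multiplication by an integrated operator turns strong
continuity of the representation into norm continuity. -/
lemma continuous_op_mul_integrated (f : C_c(G, ℂ)) :
    Continuous fun x => π.op x * π.integrated μ f := by
  have hf : MemLp f 1 μ := memLp_one_iff_integrable.2 (integrable_compactlySupported μ f)
  have : Fact ((1 : ℝ≥0∞) ≠ ∞) := ⟨by simp⟩
  have hk : Continuous fun x : G => DomMulAct.mk x⁻¹ • hf.toLp f :=
    (DomMulAct.mkHomeomorph.continuous.comp continuous_inv).smul continuous_const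
  refine continuous_iff_continuousAt.2 fun x => ?_
  have hx := (tendsto_iff_dist_tendsto_zero.1 (hk.tendsto x))
  refine tendsto_iff_dist_tendsto_zero.2 (squeeze_zero (fun _ => dist_nonneg) (fun y => ?_) hx)
  simp only [op_mul_integrated]
  rw [dist_eq_norm, ← integrated_sub,
    DomMulAct.mk_smul_toLp, DomMulAct.mk_smul_toLp, dist_eq_norm, ← MemLp.toLp_sub,
    L1.norm_eq_integral_norm]
  refine (norm_integrated_le _ _ _).trans (le_of_eq (integral_congr_ae ?_))
  filter_upwards [MemLp.coeFn_toLp ((hf.comp_measurePreserving (measurePreserving_smul y⁻¹ μ)).sub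
    (hf.comp_measurePreserving (measurePreserving_smul x⁻¹ μ)))] with z hz
  exact (congrArg norm hz).symm

/-- Nonnegative bump functions of integral one supported near the identity. -/
lemma exists_bump {V : Set G} (hV : V ∈ 𝓝 (1 : G)) :
    ∃ f : C_c(G, ℂ), (∀ x ∉ V, f x = 0) ∧ (∫ x, f x ∂μ = 1) ∧ (∫ x, ‖f x‖ ∂μ = 1) := by
  obtain ⟨f, hf1, hf0, hfc, hf⟩ := exists_continuous_one_zero_of_isCompact
    (isCompact_singleton (x := (1 : G))) (isClosed_compl_iff.2 (isOpen_interior (s := V)))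
    (by simpa using mem_interior_iff_mem_nhds.2 hV)
  have hf0' : ∀ x ∉ V, f x = 0 := fun x hx => hf0 fun h => hx (interior_subset h)
  have hpos : 0 < ∫ x, f x ∂μ :=
    f.continuous.integral_pos_of_hasCompactSupport_nonneg_nonzero hfc (fun x => (hf x).1)
      (x := 1) (by simp [hf1 (Set.mem_singleton 1)])
  set c := ∫ x, f x ∂μ with hc
  have hn : ∀ x, ‖((c⁻¹ * f x : ℝ) : ℂ)‖ = c⁻¹ * f x := fun x => by
    rw [Complex.norm_real, Real.norm_of_nonneg (mul_nonneg (inv_nonneg.2 hpos.le) (hf x).1)]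
  refine ⟨⟨⟨fun x => ((c⁻¹ * f x : ℝ) : ℂ), by fun_prop⟩, ?_⟩, fun x hx => ?_, ?_, ?_⟩
  · exact hfc.comp_left (g := fun t : ℝ => ((c⁻¹ * t : ℝ) : ℂ)) (by simp)
  · simp [hf0' x hx]
  · change ∫ x, ((c⁻¹ * f x : ℝ) : ℂ) ∂μ = 1
    rw [integral_complex_ofReal, integral_const_mul, inv_mul_cancel₀ hpos.ne', Complex.ofReal_one]
  · change ∫ x, ‖((c⁻¹ * f x : ℝ) : ℂ)‖ ∂μ = 1
    simp_rw [hn]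
    rw [integral_const_mul, inv_mul_cancel₀ hpos.ne']

/-- Averaging against a bump function changes a function little if it varies little on the support
of the bump. -/
lemma norm_integral_bump_smul_sub_le {E : Type*} [NormedAddCommGroup E] [NormedSpace ℂ E]
    [CompleteSpace E] {V : Set G} {f : C_c(G, ℂ)} (hf : ∀ x ∉ V, f x = 0) (h1 : ∫ x, f x ∂μ = 1)
    (h2 : ∫ x, ‖f x‖ ∂μ = 1) {k : G → E} (hk : Continuous k) {a : E} {ε : ℝ}
    (hε : ∀ x ∈ V, ‖k x - a‖ ≤ ε) : ‖(∫ x, f x • k x ∂μ) - a‖ ≤ ε := by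
  have hi : ∀ l : G → E, Continuous l → Integrable (fun x => f x • l x) μ := fun l hl =>
    (f.continuous.smul hl).integrable_of_hasCompactSupport f.hasCompactSupport.smul_right
  have ha : (∫ x, f x • k x ∂μ) - a = ∫ x, f x • (k x - a) ∂μ := by
    simp_rw [smul_sub]
    rw [integral_sub (hi k hk) (hi _ continuous_const), integral_smul_const, h1, one_smul]
  rw [ha]
  calc ‖∫ x, f x • (k x - a) ∂μ‖ ≤ ∫ x, ‖f x‖ * ε ∂μ := by
        refine norm_integral_le_of_norm_le
          ((integrable_compactlySupported μ f).norm.mul_const ε) (Eventually.of_forall fun x => ?_)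
        rw [norm_smul]
        by_cases hx : x ∈ V
        · exact mul_le_mul_of_nonneg_left (hε x hx) (norm_nonneg _)
        · simp [hf x hx]
    _ = ε := by rw [integral_mul_const, h2, one_mul]

/-- The integrated operators contain approximate identities. -/
lemma exists_norm_integrated_sub_le (v : H) {ε : ℝ} (hε : 0 < ε) :
    ∃ f : C_c(G, ℂ), ‖π.integrated μ f v - v‖ ≤ ε := by
  obtain ⟨f, hf, h1, h2⟩ := exists_bump μ (V := {x | ‖π.op x v - v‖ < ε}) (by
    refine (isOpen_lt ((π.continuous_op_apply v).sub continuous_const).norm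
      continuous_const).mem_nhds ?_
    simp [op_one, hε])
  exact ⟨f, norm_integral_bump_smul_sub_le μ hf h1 h2 (π.continuous_op_apply v)
    fun x hx => le_of_lt hx⟩

end Regular

end Integrated
end UnitaryRep

end

/-! ### Characters of the algebra generated by a unitary representation -/

section

open WeakDual

/-- The Fourier transform of a scalar function, with the conventions of `LCA.fourier`. -/
def scalarFourier {G : Type*} [CommGroup G] [TopologicalSpace G] [MeasurableSpace G]
    (μ : Measure G) (f : G → ℂ) (ξ : PontryaginDual G) : ℂ :=
  ∫ g, conj (ξ g : ℂ) * f g ∂μ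

/-- Evaluation of characters of a commutative Banach algebra is jointly continuous, for the
weak-* topology on the character space and the norm topology on the algebra. -/
lemma continuous_characterSpace_eval (A : Type*) [CommCStarAlgebra A] :
    Continuous fun q : characterSpace ℂ A × A => q.1 q.2 := by
  refine continuous_iff_continuousAt.2 fun q₀ => ?_
  have h1 : Tendsto (fun q : characterSpace ℂ A × A => q.1 q₀.2) (𝓝 q₀) (𝓝 (q₀.1 q₀.2)) :=
    (((map_continuous (gelfandStarTransform A q₀.2)).comp continuous_fst).tendsto q₀)
  have h2 : Tendsto (fun q : characterSpace ℂ A × A => q.1 (q.2 - q₀.2)) (𝓝 q₀) (𝓝 0) := by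
    refine squeeze_zero_norm (a := fun q : characterSpace ℂ A × A =>
      ‖q.2 - q₀.2‖ * ‖(1 : A)‖)
      (fun q => AlgHom.norm_apply_le_self_mul_norm_one q.1 _) ?_
    have : Continuous fun q : characterSpace ℂ A × A => ‖q.2 - q₀.2‖ * ‖(1 : A)‖ := by fun_prop
    simpa using this.tendsto q₀
  have := h2.add h1
  simpa [ContinuousAt, map_sub] using this

namespace UnitaryRep

variable {G H : Type*} [CommGroup G] [TopologicalSpace G] [IsTopologicalGroup G]
  [NormedAddCommGroup H] [InnerProductSpace ℂ H] [CompleteSpace H] (π : UnitaryRep G H)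

/-- The bicommutant of a unitary representation: the operators that commute with every operator
commuting with the representation. -/
def bicommutant : StarSubalgebra ℂ (H →L[ℂ] H) where
  carrier := {a | ∀ b : H →L[ℂ] H, (∀ x, b * π.op x = π.op x * b) → b * a = a * b}
  mul_mem' := fun {a c} ha hc b hb => by
    rw [← mul_assoc, ha b hb, mul_assoc, hc b hb, mul_assoc]
  add_mem' := fun {a c} ha hc b hb => by rw [mul_add, add_mul, ha b hb, hc b hb]
  algebraMap_mem' := fun r b _ => (Algebra.commutes r b).symm
  star_mem' := fun {a} ha b hb => by
    have h : star b * a = a * star b := ha (star b) fun x => by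
      have := congrArg star (hb x⁻¹)
      rwa [star_mul, star_mul, star_op, inv_inv, eq_comm] at this
    simpa using (congrArg star h).symm

lemma op_mem_bicommutant (x : G) : π.op x ∈ π.bicommutant := fun _ hb => hb x

instance isClosed_bicommutant : IsClosed (π.bicommutant : Set (H →L[ℂ] H)) := by
  have : (π.bicommutant : Set (H →L[ℂ] H)) =
      Set.centralizer {b | ∀ x, b * π.op x = π.op x * b} := rfl
  rw [this]
  exact Set.isClosed_centralizer _

instance : CommCStarAlgebra π.bicommutant where
  __ := StarSubalgebra.cstarAlgebra π.bicommutant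
  mul_comm a b := Subtype.ext <| b.2 a.1 fun x => by
    have := a.2 (π.op x) fun y => by rw [← op_mul, ← op_mul, mul_comm]
    exact this.symm

/-- The operator of a group element, in the bicommutant. -/
def opB (x : G) : π.bicommutant := ⟨π.op x, π.op_mem_bicommutant x⟩

lemma opB_mul (x y : G) : π.opB (x * y) = π.opB x * π.opB y := Subtype.ext (π.op_mul x y)

lemma opB_one : π.opB 1 = 1 := Subtype.ext π.op_one

lemma norm_character_opB (χ : characterSpace ℂ π.bicommutant) (x : G) : ‖χ (π.opB x)‖ = 1 := by
  have h : star (π.opB x) * π.opB x = 1 := Subtype.ext (π.star_op_mul_op x)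
  have h2 := congrArg χ h
  rw [map_mul, map_star, map_one] at h2
  have h3 := congrArg norm h2
  rw [norm_mul, norm_star, norm_one] at h3
  nlinarith [norm_nonneg (χ (π.opB x))]

variable [MeasurableSpace G] [BorelSpace G] (μ : Measure G) [μ.IsHaarMeasure]

/-- The integrated operator of a compactly supported function, in the bicommutant. -/
def integratedB (f : C_c(G, ℂ)) : π.bicommutant :=
  ⟨π.integrated μ f, fun _ hb => π.commute_integrated μ f hb⟩

/-- The characters of the bicommutant that do not vanish on all integrated operators. The others
form the part at infinity. -/
def finitePart : Set (characterSpace ℂ π.bicommutant) :=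
  {χ | ∃ f : C_c(G, ℂ), χ (π.integratedB μ f) ≠ 0}

lemma continuous_character_apply (a : π.bicommutant) :
    Continuous fun χ : characterSpace ℂ π.bicommutant => χ a :=
  map_continuous (gelfandStarTransform π.bicommutant a)

lemma isOpen_finitePart : IsOpen (π.finitePart μ) := by
  have : π.finitePart μ = ⋃ f : C_c(G, ℂ), {χ | χ (π.integratedB μ f) ≠ 0} := by
    ext; simp [finitePart]
  rw [this]
  exact isOpen_iUnion fun f => isOpen_ne_fun (π.continuous_character_apply _) continuous_const

variable [T2Space G] [LocallyCompactSpace G] [μ.Regular]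

lemma continuous_opB_mul_integratedB (f : C_c(G, ℂ)) :
    Continuous fun x => π.opB x * π.integratedB μ f :=
  (π.continuous_op_mul_integrated μ f).subtype_mk _

/-- Characters are norm continuous, and `x ↦ π(x) π(f)` is norm continuous although `x ↦ π(x)` is
not. -/
lemma continuous_character_opB {χ : characterSpace ℂ π.bicommutant} (hχ : χ ∈ π.finitePart μ) :
    Continuous fun x => χ (π.opB x) := by
  obtain ⟨f, hf⟩ := hχ
  have h : (fun x => χ (π.opB x)) = fun x => χ (π.opB x * π.integratedB μ f) /
      χ (π.integratedB μ f) := by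
    ext x
    rw [map_mul, mul_div_cancel_right₀ _ hf]
  rw [h]
  exact ((map_continuous χ).comp (π.continuous_opB_mul_integratedB μ f)).div_const _

/-- A character of the bicommutant that is finite in the sense of `finitePart` restricts to a
continuous character of the group. The complex conjugate is taken so that integrated operators are
evaluated by `scalarFourier`. -/
lemma exists_dual {χ : characterSpace ℂ π.bicommutant} (hχ : χ ∈ π.finitePart μ) :
    ∃ ξ : PontryaginDual G, ∀ x, χ (π.opB x) = conj (ξ x : ℂ) := by
  let ξ : G →ₜ* Circle :=
    { toFun := fun x => ⟨conj (χ (π.opB x)), by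
        simp [Submonoid.unitSphere, norm_character_opB]⟩
      map_one' := by ext; simp [opB_one]
      map_mul' := fun x y => by
        ext
        simp only [opB_mul, map_mul]
        rfl
      continuous_toFun := by
        exact (Complex.continuous_conj.comp (π.continuous_character_opB μ hχ)).subtype_mk _ }
  exact ⟨ξ, fun x => (Complex.conj_conj _).symm⟩

open Classical in
/-- The point of the dual group given by a character of the bicommutant; by convention it is `1` for
characters at infinity. -/
def dualPoint (χ : characterSpace ℂ π.bicommutant) : PontryaginDual G :=
  if h : χ ∈ π.finitePart μ then (π.exists_dual μ h).choose else 1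

lemma character_opB {χ : characterSpace ℂ π.bicommutant} (hχ : χ ∈ π.finitePart μ) (x : G) :
    χ (π.opB x) = conj (π.dualPoint μ χ x : ℂ) := by
  rw [dualPoint, dif_pos hχ]
  exact (π.exists_dual μ hχ).choose_spec x

/-- A character of the bicommutant evaluates an integrated operator by the Fourier transform. -/
lemma character_integratedB {χ : characterSpace ℂ π.bicommutant} (hχ : χ ∈ π.finitePart μ)
    (f : C_c(G, ℂ)) :
    χ (π.integratedB μ f) = scalarFourier μ f (π.dualPoint μ χ) := by
  obtain ⟨h, hh⟩ := id hχ
  have hc := π.continuous_opB_mul_integratedB μ h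
  have hint : Integrable (fun x => f x • (π.opB x * π.integratedB μ h)) μ :=
    (f.continuous.smul hc).integrable_of_hasCompactSupport f.hasCompactSupport.smul_right
  have h1 : π.integratedB μ f * π.integratedB μ h =
      ∫ x, f x • (π.opB x * π.integratedB μ h) ∂μ := by
    refine Subtype.ext ?_
    have := (π.bicommutant.subtype.toLinearMap.mkContinuous 1
      (fun a => by simp [one_mul])).integral_comp_comm hint
    exact (π.integrated_mul_apply μ f _ (π.continuous_op_mul_integrated μ h)).trans this
  have h2 : χ (∫ x, f x • (π.opB x * π.integratedB μ h) ∂μ) =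
      ∫ x, χ (f x • (π.opB x * π.integratedB μ h)) ∂μ :=
    ((WeakDual.toStrongDual (χ : WeakDual ℂ π.bicommutant)).integral_comp_comm hint).symm
  rw [← h1, map_mul] at h2
  refine mul_right_cancel₀ hh (h2.trans ?_)
  rw [scalarFourier, ← integral_mul_const]
  refine integral_congr_ae (Eventually.of_forall fun x => ?_)
  simp only [map_smul, map_mul, π.character_opB μ hχ, smul_eq_mul]
  ring

/-- Continuity for the compact-open topology, which follows from joint continuity in the character
and the group element. -/
lemma continuousOn_dualPoint : ContinuousOn (π.dualPoint μ) (π.finitePart μ) := by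
  rw [continuousOn_iff_continuous_domRestrict]
  refine ContinuousMonoidHom.continuous_of_continuous_uncurry
    (fun χ : π.finitePart μ => (π.dualPoint μ χ : G →ₜ* Circle)) ?_
  refine continuous_induced_rng.2 (continuous_iff_continuousAt.2 fun q₀ => ?_)
  obtain ⟨f, hf⟩ := q₀.1.2
  have hnum : Continuous fun q : π.finitePart μ × G =>
      (q.1 : characterSpace ℂ π.bicommutant) (π.opB q.2 * π.integratedB μ f) :=
    (continuous_characterSpace_eval π.bicommutant).comp
      ((continuous_subtype_val.comp continuous_fst).prodMk
        ((π.continuous_opB_mul_integratedB μ f).comp continuous_snd))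
  have hden : Continuous fun q : π.finitePart μ × G =>
      (q.1 : characterSpace ℂ π.bicommutant) (π.integratedB μ f) :=
    (π.continuous_character_apply _).comp (continuous_subtype_val.comp continuous_fst)
  have h : ContinuousAt (fun q : π.finitePart μ × G =>
      conj ((q.1 : characterSpace ℂ π.bicommutant) (π.opB q.2 * π.integratedB μ f) /
        (q.1 : characterSpace ℂ π.bicommutant) (π.integratedB μ f))) q₀ :=
    Complex.continuous_conj.continuousAt.comp (hnum.continuousAt.div hden.continuousAt hf)
  refine h.congr ?_
  filter_upwards [hden.continuousAt.eventually_ne hf] with q hq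
  rw [map_mul, mul_div_cancel_right₀ _ hq, π.character_opB μ q.1.2, Complex.conj_conj]
  rfl

end UnitaryRep

end

/-! ### The functional calculus over the dual group -/

section

open WeakDual

section Dual

variable {G : Type*} [CommGroup G] [TopologicalSpace G] [IsTopologicalGroup G]
  [T2Space G] [LocallyCompactSpace G]

lemma continuous_dual_eval : Continuous fun q : PontryaginDual G × G => (q.1 q.2 : ℂ) := by
  have : Continuous fun q : (G →ₜ* Circle) × G => q.1 q.2 := continuous_eval
  exact continuous_subtype_val.comp this

variable [MeasurableSpace G] [BorelSpace G] (μ : Measure G) [μ.IsHaarMeasure] [μ.Regular]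

/-- On a compact set of characters, some Fourier transform is bounded away from zero. -/
lemma exists_le_norm_scalarFourier {C : Set (PontryaginDual G)} (hC : IsCompact C) :
    ∃ f : C_c(G, ℂ), ∀ ξ ∈ C, 1 / 2 ≤ ‖scalarFourier μ f ξ‖ := by
  have hV : ∀ᶠ x in 𝓝 (1 : G), ∀ ξ ∈ C, ‖conj (ξ x : ℂ) - 1‖ < 1 / 2 := by
    refine hC.eventually_forall_of_forall_eventually fun ξ _ => ?_
    have hc : Continuous fun q : G × PontryaginDual G => ‖conj (q.2 q.1 : ℂ) - 1‖ :=
      ((Complex.continuous_conj.comp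
        (continuous_dual_eval.comp continuous_swap)).sub continuous_const).norm
    refine hc.continuousAt.eventually_lt continuousAt_const ?_
    simp
  obtain ⟨f, hf, h1, h2⟩ := UnitaryRep.exists_bump μ hV
  refine ⟨f, fun ξ hξ => ?_⟩
  have hk : Continuous fun x => conj (ξ x : ℂ) :=
    Complex.continuous_conj.comp (continuous_subtype_val.comp (map_continuous ξ))
  have h := UnitaryRep.norm_integral_bump_smul_sub_le μ hf h1 h2 hk (a := 1) (ε := 1 / 2)
    fun x hx => (hx ξ hξ).le
  have h3 : scalarFourier μ f ξ = ∫ x, f x • conj (ξ x : ℂ) ∂μ := by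
    simp [scalarFourier, mul_comm]
  rw [← h3] at h
  have := norm_sub_norm_le (1 : ℂ) (1 - scalarFourier μ f ξ)
  rw [sub_sub_cancel, norm_one, norm_sub_rev] at this
  linarith

lemma continuous_scalarFourier (f : C_c(G, ℂ)) : Continuous (scalarFourier μ f) := by
  rw [← continuousOn_univ]
  refine continuousOn_integral_of_compact_support (k := tsupport f) f.hasCompactSupport.isCompact
    (Continuous.continuousOn ?_) fun ξ x _ hx => ?_
  · exact (Complex.continuous_conj.comp continuous_dual_eval).mul
      (f.continuous.comp continuous_snd)
  · rw [image_eq_zero_of_notMem_tsupport hx, mul_zero]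

end Dual

namespace UnitaryRep

variable {G H : Type*} [CommGroup G] [TopologicalSpace G] [IsTopologicalGroup G]
  [NormedAddCommGroup H] [InnerProductSpace ℂ H] [CompleteSpace H] (π : UnitaryRep G H)
  [MeasurableSpace G] [BorelSpace G] (μ : Measure G) [μ.IsHaarMeasure]
  [T2Space G] [LocallyCompactSpace G] [μ.Regular]

/-- The inverse Gelfand transform of the bicommutant, as an operator on `H`. -/
def ofGelfand (F : C(characterSpace ℂ π.bicommutant, ℂ)) : H →L[ℂ] H :=
  ((gelfandStarTransform π.bicommutant).symm F : π.bicommutant)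

lemma ofGelfand_mul (F K : C(characterSpace ℂ π.bicommutant, ℂ)) :
    π.ofGelfand (F * K) = π.ofGelfand F * π.ofGelfand K := by
  simp [ofGelfand]

lemma ofGelfand_add (F K : C(characterSpace ℂ π.bicommutant, ℂ)) :
    π.ofGelfand (F + K) = π.ofGelfand F + π.ofGelfand K := by
  simp [ofGelfand]

lemma ofGelfand_sub (F K : C(characterSpace ℂ π.bicommutant, ℂ)) :
    π.ofGelfand (F - K) = π.ofGelfand F - π.ofGelfand K := by
  simp [ofGelfand]

lemma ofGelfand_smul (c : ℂ) (F : C(characterSpace ℂ π.bicommutant, ℂ)) :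
    π.ofGelfand (c • F) = c • π.ofGelfand F := by
  simp [ofGelfand]

lemma ofGelfand_one : π.ofGelfand 1 = 1 := by
  simp [ofGelfand]

lemma ofGelfand_star (F : C(characterSpace ℂ π.bicommutant, ℂ)) :
    π.ofGelfand (star F) = star (π.ofGelfand F) := by
  simp [ofGelfand, map_star]

lemma norm_ofGelfand (F : C(characterSpace ℂ π.bicommutant, ℂ)) : ‖π.ofGelfand F‖ = ‖F‖ := by
  exact StarAlgEquiv.norm_map (gelfandStarTransform π.bicommutant).symm F

lemma ofGelfand_gelfand (a : π.bicommutant) :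
    π.ofGelfand (gelfandStarTransform π.bicommutant a) = a := by
  simp [ofGelfand]

lemma inner_ofGelfand_star_mul (F K : C(characterSpace ℂ π.bicommutant, ℂ)) (v : H) :
    inner ℂ v (π.ofGelfand (star K * F * K) v) =
      inner ℂ (π.ofGelfand K v) (π.ofGelfand F (π.ofGelfand K v)) := by
  rw [ofGelfand_mul, ofGelfand_mul, ofGelfand_star, mul_apply_eq_comp, mul_apply_eq_comp,
    ContinuousLinearMap.star_eq_adjoint, ContinuousLinearMap.adjoint_inner_right]

/-- The functional calculus is positive, since nonnegative functions have square roots. -/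
lemma re_inner_ofGelfand_nonneg {F : C(characterSpace ℂ π.bicommutant, ℂ)}
    {r : characterSpace ℂ π.bicommutant → ℝ} (hr : Continuous r) (h0 : ∀ χ, 0 ≤ r χ)
    (hF : ∀ χ, F χ = r χ) (v : H) : 0 ≤ (inner ℂ v (π.ofGelfand F v)).re := by
  let K : C(characterSpace ℂ π.bicommutant, ℂ) :=
    ⟨fun χ => (Real.sqrt (r χ) : ℂ), Complex.continuous_ofReal.comp hr.sqrt⟩
  have hK : F = star K * 1 * K := by
    ext χ
    have : (Real.sqrt (r χ) : ℂ) * (Real.sqrt (r χ) : ℂ) = r χ := by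
      rw [← Complex.ofReal_mul, Real.mul_self_sqrt (h0 χ)]
    simp [hF, K, this]
  rw [hK, inner_ofGelfand_star_mul, ofGelfand_one]
  exact inner_self_nonneg (𝕜 := ℂ) (x := π.ofGelfand K v)

open Classical in
/-- The extension by zero to the whole character space. -/
def pullbackFun (φ : PontryaginDual G → ℝ) (χ : characterSpace ℂ π.bicommutant) : ℝ :=
  if χ ∈ π.finitePart μ then φ (π.dualPoint μ χ) else 0

lemma pullbackFun_of_mem (φ : PontryaginDual G → ℝ) {χ : characterSpace ℂ π.bicommutant}
    (h : χ ∈ π.finitePart μ) : π.pullbackFun μ φ χ = φ (π.dualPoint μ χ) := if_pos h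

lemma pullbackFun_of_notMem (φ : PontryaginDual G → ℝ) {χ : characterSpace ℂ π.bicommutant}
    (h : χ ∉ π.finitePart μ) : π.pullbackFun μ φ χ = 0 := if_neg h

/-- Near a point at infinity the extension vanishes: on the support of `φ` some `|f̂|` is at least
`1 / 2`, while the character is small on the operator of `f`. -/
lemma continuous_pullbackFun (φ : C_c(PontryaginDual G, ℝ)) :
    Continuous (π.pullbackFun μ φ) := by
  obtain ⟨f, hf⟩ := exists_le_norm_scalarFourier μ (G := G) φ.hasCompactSupport.isCompact
  have hcf := (π.continuous_character_apply (π.integratedB μ f)).norm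
  refine continuous_iff_continuousAt.2 fun χ₀ => ?_
  by_cases hχ : χ₀ ∈ π.finitePart μ
  · have h1 : ContinuousAt (fun χ => φ (π.dualPoint μ χ)) χ₀ :=
      (map_continuous φ).continuousAt.comp
        ((π.continuousOn_dualPoint μ).continuousAt ((π.isOpen_finitePart μ).mem_nhds hχ))
    refine h1.congr ?_
    filter_upwards [(π.isOpen_finitePart μ).mem_nhds hχ] with χ h
    rw [pullbackFun_of_mem _ _ _ h]
  · have h0 : χ₀ (π.integratedB μ f) = 0 := by
      by_contra h
      exact hχ ⟨f, h⟩
    refine (continuousAt_const (y := (0 : ℝ))).congr ?_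
    filter_upwards [hcf.continuousAt.eventually_lt (continuousAt_const (y := 1 / 2))
      (by simp [h0])] with χ h
    by_cases hm : χ ∈ π.finitePart μ
    · rw [pullbackFun_of_mem _ _ _ hm]
      by_contra hne
      rw [character_integratedB _ _ hm] at h
      exact absurd (hf _ (subset_tsupport _ (Ne.symm hne))) (not_le.2 h)
    · rw [pullbackFun_of_notMem _ _ _ hm]

/-- A compactly supported function on the dual group, as a function on the character space of the
bicommutant that vanishes at infinity. -/
def pullback (φ : C_c(PontryaginDual G, ℝ)) : C(characterSpace ℂ π.bicommutant, ℂ) :=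
  ⟨fun χ => (π.pullbackFun μ φ χ : ℂ),
    Complex.continuous_ofReal.comp (π.continuous_pullbackFun μ φ)⟩

lemma pullback_apply (φ : C_c(PontryaginDual G, ℝ)) (χ : characterSpace ℂ π.bicommutant) :
    π.pullback μ φ χ = π.pullbackFun μ φ χ := rfl

/-- The spectral functional `φ ↦ ⟪v, φ(π) v⟫` of a vector `v`. -/
def spectral (v : H) : C_c(PontryaginDual G, ℝ) →ₚ[ℝ] ℝ :=
  PositiveLinearMap.mk₀
    { toFun := fun φ => (inner ℂ v (π.ofGelfand (π.pullback μ φ) v)).re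
      map_add' := fun φ ψ => by
        have : π.pullback μ (φ + ψ) = π.pullback μ φ + π.pullback μ ψ := by
          ext χ
          by_cases h : χ ∈ π.finitePart μ <;>
            simp [pullback_apply, h, pullbackFun]
        rw [this, ofGelfand_add, _root_.add_apply, inner_add_right, Complex.add_re]
      map_smul' := fun c φ => by
        have : π.pullback μ (c • φ) = (c : ℂ) • π.pullback μ φ := by
          ext χ
          by_cases h : χ ∈ π.finitePart μ <;>
            simp [pullback_apply, h, pullbackFun]
        rw [this, ofGelfand_smul, _root_.smul_apply, inner_smul_right, Complex.re_ofReal_mul]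
        rfl }
    fun φ hφ => π.re_inner_ofGelfand_nonneg (π.continuous_pullbackFun μ φ) (fun χ => by
      by_cases h : χ ∈ π.finitePart μ
      · rw [pullbackFun_of_mem _ _ _ h]; exact hφ _
      · rw [pullbackFun_of_notMem _ _ _ h]) (fun _ => rfl) v

lemma spectral_apply (v : H) (φ : C_c(PontryaginDual G, ℝ)) :
    π.spectral μ v φ = (inner ℂ v (π.ofGelfand (π.pullback μ φ) v)).re := rfl

lemma spectral_le (v : H) {φ : C_c(PontryaginDual G, ℝ)} (hφ : ∀ ξ, φ ξ ≤ 1) :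
    π.spectral μ v φ ≤ ‖v‖ ^ 2 := by
  have h := π.re_inner_ofGelfand_nonneg (F := 1 - π.pullback μ φ)
    (r := fun χ => 1 - π.pullbackFun μ φ χ)
    (continuous_const.sub (π.continuous_pullbackFun μ φ)) (fun χ => by
      by_cases h : χ ∈ π.finitePart μ
      · rw [pullbackFun_of_mem _ _ _ h]; linarith [hφ (π.dualPoint μ χ)]
      · rw [pullbackFun_of_notMem _ _ _ h]; norm_num) (fun χ => by simp [pullback_apply]) v
  rw [ofGelfand_sub, ofGelfand_one, _root_.sub_apply, inner_sub_right, Complex.sub_re] at h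
  have h2 : (inner ℂ v ((1 : H →L[ℂ] H) v)).re = ‖v‖ ^ 2 :=
    inner_self_eq_norm_sq (𝕜 := ℂ) v
  rw [h2] at h
  rw [spectral_apply]
  linarith

lemma pullbackFun_mem_Icc {φ : C_c(PontryaginDual G, ℝ)} (h0 : ∀ ξ, 0 ≤ φ ξ) (h1 : ∀ ξ, φ ξ ≤ 1)
    (χ : characterSpace ℂ π.bicommutant) : π.pullbackFun μ φ χ ∈ Set.Icc (0 : ℝ) 1 := by
  by_cases h : χ ∈ π.finitePart μ
  · rw [pullbackFun_of_mem _ _ _ h]; exact ⟨h0 _, h1 _⟩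
  · rw [pullbackFun_of_notMem _ _ _ h]; simp

lemma norm_one_sub_pullback {φ : C_c(PontryaginDual G, ℝ)} (h0 : ∀ ξ, 0 ≤ φ ξ)
    (h1 : ∀ ξ, φ ξ ≤ 1) (χ : characterSpace ℂ π.bicommutant) :
    ‖(1 - π.pullback μ φ) χ‖ = 1 - π.pullbackFun μ φ χ := by
  rw [ContinuousMap.sub_apply, pullback_apply, ContinuousMap.one_apply, ← Complex.ofReal_one,
    ← Complex.ofReal_sub, Complex.norm_real, Real.norm_of_nonneg]
  linarith [(π.pullbackFun_mem_Icc μ h0 h1 χ).2]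

lemma norm_ofGelfand_one_sub_pullback_le {φ : C_c(PontryaginDual G, ℝ)} (h0 : ∀ ξ, 0 ≤ φ ξ)
    (h1 : ∀ ξ, φ ξ ≤ 1) : ‖π.ofGelfand (1 - π.pullback μ φ)‖ ≤ 1 := by
  rw [norm_ofGelfand, ContinuousMap.norm_le _ zero_le_one]
  intro χ
  rw [norm_one_sub_pullback _ _ h0 h1]
  linarith [(π.pullbackFun_mem_Icc μ h0 h1 χ).1]

lemma norm_ofGelfand_one_sub_pullback_mul_le {φ : C_c(PontryaginDual G, ℝ)} (h0 : ∀ ξ, 0 ≤ φ ξ)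
    (h1 : ∀ ξ, φ ξ ≤ 1) {f : C_c(G, ℂ)} {δ : ℝ} (hδ : 0 < δ)
    (h : ∀ χ : characterSpace ℂ π.bicommutant, δ ≤ ‖χ (π.integratedB μ f)‖ →
      φ (π.dualPoint μ χ) = 1) :
    ‖π.ofGelfand (1 - π.pullback μ φ) * π.integrated μ f‖ ≤ δ := by
  have : π.integrated μ f = π.ofGelfand (gelfandStarTransform π.bicommutant (π.integratedB μ f)) :=
    (π.ofGelfand_gelfand (π.integratedB μ f)).symm
  rw [this, ← ofGelfand_mul, norm_ofGelfand, ContinuousMap.norm_le _ hδ.le]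
  intro χ
  rw [ContinuousMap.mul_apply, norm_mul, norm_one_sub_pullback _ _ h0 h1,
    gelfandStarTransform_apply_apply]
  rcases le_or_gt δ ‖χ (π.integratedB μ f)‖ with hχ | hχ
  · have hm : χ ∈ π.finitePart μ := ⟨f, norm_pos_iff.1 (hδ.trans_le hχ)⟩
    rw [pullbackFun_of_mem _ _ _ hm, h χ hχ, sub_self, zero_mul]
    exact hδ.le
  · have h01 := π.pullbackFun_mem_Icc μ h0 h1 χ
    nlinarith [h01.1, h01.2, norm_nonneg (χ (π.integratedB μ f))]

/-- A lower bound for the spectral functional, from a function that equals one wherever the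
transform of a good approximate identity is not small. -/
lemma sub_le_spectral (v : H) {φ : C_c(PontryaginDual G, ℝ)} (h0 : ∀ ξ, 0 ≤ φ ξ)
    (h1 : ∀ ξ, φ ξ ≤ 1) {f : C_c(G, ℂ)} {δ : ℝ} (hδ : 0 < δ)
    (hf : ‖π.integrated μ f v - v‖ ≤ δ)
    (h : ∀ χ : characterSpace ℂ π.bicommutant, δ ≤ ‖χ (π.integratedB μ f)‖ →
      φ (π.dualPoint μ χ) = 1) :
    ‖v‖ ^ 2 - (δ * ‖v‖ + δ) * ‖v‖ ≤ π.spectral μ v φ := by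
  have hs := π.norm_ofGelfand_one_sub_pullback_mul_le μ h0 h1 hδ h
  have hb := π.norm_ofGelfand_one_sub_pullback_le μ h0 h1
  have key : ‖π.ofGelfand (1 - π.pullback μ φ) v‖ ≤ δ * ‖v‖ + δ := by
    have e : π.ofGelfand (1 - π.pullback μ φ) v =
        (π.ofGelfand (1 - π.pullback μ φ) * π.integrated μ f) v -
          π.ofGelfand (1 - π.pullback μ φ) (π.integrated μ f v - v) := by
      rw [map_sub, mul_apply_eq_comp, sub_sub_cancel]
    rw [e]
    refine (norm_sub_le _ _).trans (add_le_add (ContinuousLinearMap.le_of_opNorm_le _ hs v) ?_)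
    exact ((ContinuousLinearMap.le_of_opNorm_le _ hb _).trans (by rw [one_mul])).trans hf
  have hre : ‖v‖ ^ 2 - π.spectral μ v φ = (inner ℂ v (π.ofGelfand (1 - π.pullback μ φ) v)).re := by
    have h2 : (inner ℂ v ((1 : H →L[ℂ] H) v)).re = ‖v‖ ^ 2 :=
      inner_self_eq_norm_sq (𝕜 := ℂ) v
    rw [ofGelfand_sub, ofGelfand_one, _root_.sub_apply, inner_sub_right, Complex.sub_re, h2]
    rfl
  have h3 : (inner ℂ v (π.ofGelfand (1 - π.pullback μ φ) v)).re ≤ (δ * ‖v‖ + δ) * ‖v‖ := by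
    refine (Complex.re_le_norm _).trans ((norm_inner_le_norm _ _).trans ?_)
    rw [mul_comm]
    exact mul_le_mul_of_nonneg_right key (norm_nonneg _)
  linarith

/-- The spectral measure of `v` has total mass `‖v‖²`: no mass escapes to infinity. -/
lemma exists_sub_le_spectral (v : H) {ε : ℝ} (hε : 0 < ε) :
    ∃ φ : C_c(PontryaginDual G, ℝ), (∀ ξ, 0 ≤ φ ξ) ∧ (∀ ξ, φ ξ ≤ 1) ∧
      ‖v‖ ^ 2 - ε ≤ π.spectral μ v φ := by
  obtain ⟨δ, hδ, hδε⟩ : ∃ δ > 0, (δ * ‖v‖ + δ) * ‖v‖ ≤ ε := by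
    refine ⟨ε / ((‖v‖ + 1) * (‖v‖ + 1)), by positivity, ?_⟩
    have hv := norm_nonneg v
    rw [show (ε / ((‖v‖ + 1) * (‖v‖ + 1)) * ‖v‖ + ε / ((‖v‖ + 1) * (‖v‖ + 1))) * ‖v‖ =
      ε * (‖v‖ / (‖v‖ + 1)) by field_simp]
    exact mul_le_of_le_one_right hε.le ((div_le_one (by positivity)).2 (by linarith))
  obtain ⟨f, hf⟩ := π.exists_norm_integrated_sub_le μ v hδ
  have hE : IsCompact {χ : characterSpace ℂ π.bicommutant | δ ≤ ‖χ (π.integratedB μ f)‖} :=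
    (isClosed_le continuous_const (π.continuous_character_apply _).norm).isCompact
  have hEf : {χ : characterSpace ℂ π.bicommutant | δ ≤ ‖χ (π.integratedB μ f)‖} ⊆
      π.finitePart μ := fun χ hχ => ⟨f, norm_pos_iff.1 (hδ.trans_le hχ)⟩
  obtain ⟨φ, h1, -, hc, h01⟩ := exists_continuous_one_zero_of_isCompact
    (hE.image_of_continuousOn ((π.continuousOn_dualPoint μ).mono hEf)) isClosed_empty
    (Set.disjoint_empty _)
  refine ⟨⟨φ, hc⟩, fun ξ => (h01 ξ).1, fun ξ => (h01 ξ).2, ?_⟩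
  have := π.sub_le_spectral μ v (φ := ⟨φ, hc⟩) (fun ξ => (h01 ξ).1) (fun ξ => (h01 ξ).2) hδ hf
    fun χ hχ => h1 ⟨χ, hχ, rfl⟩
  linarith

/-- Applying an integrated operator multiplies the spectral measure by `|f̂|²`. -/
lemma spectral_integrated (f : C_c(G, ℂ)) (v : H) {φ ψ : C_c(PontryaginDual G, ℝ)}
    (h : ∀ ξ, ψ ξ = φ ξ * ‖scalarFourier μ f ξ‖ ^ 2) :
    π.spectral μ (π.integrated μ f v) φ = π.spectral μ v ψ := by
  set K := gelfandStarTransform π.bicommutant (π.integratedB μ f)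
  have hK : π.integrated μ f = π.ofGelfand K := (π.ofGelfand_gelfand (π.integratedB μ f)).symm
  have hψ : π.pullback μ ψ = star K * π.pullback μ φ * K := by
    ext χ
    rw [pullback_apply, ContinuousMap.mul_apply, ContinuousMap.mul_apply, pullback_apply,
      ContinuousMap.star_apply, gelfandStarTransform_apply_apply]
    by_cases hm : χ ∈ π.finitePart μ
    · rw [pullbackFun_of_mem _ _ _ hm, pullbackFun_of_mem _ _ _ hm, h,
        character_integratedB _ _ hm, Complex.ofReal_mul, Complex.ofReal_pow,
        ← Complex.conj_mul', Complex.star_def]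
      ring
    · rw [pullbackFun_of_notMem _ _ _ hm, pullbackFun_of_notMem _ _ _ hm]
      simp
  rw [spectral_apply, spectral_apply, hψ, inner_ofGelfand_star_mul, hK]

end UnitaryRep

end

/-! ### Covariance of the functional calculus under modulation -/

section

open WeakDual

/-- The product of a compactly supported function and a character. -/
def modulate {G : Type*} [CommGroup G] [TopologicalSpace G] (η : PontryaginDual G)
    (f : C_c(G, ℂ)) : C_c(G, ℂ) where
  toFun x := (η x : ℂ) * f x
  continuous_toFun := (continuous_subtype_val.comp (map_continuous η)).mul f.continuous
  hasCompactSupport' := f.hasCompactSupport.mul_left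

lemma modulate_apply {G : Type*} [CommGroup G] [TopologicalSpace G] (η : PontryaginDual G)
    (f : C_c(G, ℂ)) (x : G) : modulate η f x = (η x : ℂ) * f x := rfl

namespace UnitaryRep

variable {G H : Type*} [CommGroup G] [TopologicalSpace G] [IsTopologicalGroup G]
  [NormedAddCommGroup H] [InnerProductSpace ℂ H] [CompleteSpace H] (π : UnitaryRep G H)

/-- A unitary operator intertwines `π` with its twist by the character `η`. -/
def Twists (W : unitary (H →L[ℂ] H)) (η : PontryaginDual G) : Prop :=
  ∀ x, (W : H →L[ℂ] H) * π.op x = (η x : ℂ) • (π.op x * (W : H →L[ℂ] H))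

variable {π} {W : unitary (H →L[ℂ] H)} {η : PontryaginDual G}

lemma circle_conj_mul_self (z : Circle) : conj (z : ℂ) * (z : ℂ) = 1 := by
  rw [Complex.conj_mul', Circle.norm_coe]; norm_num

lemma Twists.star_mul_op_mul (hW : π.Twists W η) (x : G) :
    star (W : H →L[ℂ] H) * π.op x * W = conj (η x : ℂ) • π.op x := by
  have h : π.op x * W = conj (η x : ℂ) • ((W : H →L[ℂ] H) * π.op x) := by
    rw [hW x, smul_smul, circle_conj_mul_self, one_smul]
  rw [mul_assoc, h, mul_smul_comm, ← mul_assoc, Unitary.coe_star_mul_self, one_mul]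

lemma Twists.conj_mem (hW : π.Twists W η) {a : H →L[ℂ] H} (ha : a ∈ π.bicommutant) :
    star (W : H →L[ℂ] H) * a * W ∈ π.bicommutant := by
  intro b hb
  have hc : ∀ x, (W * b * star (W : H →L[ℂ] H)) * π.op x =
      π.op x * (W * b * star (W : H →L[ℂ] H)) := fun x => by
    have h1 : star (W : H →L[ℂ] H) * π.op x =
        conj (η x : ℂ) • (π.op x * star (W : H →L[ℂ] H)) := by
      have := congrArg (fun T => T * star (W : H →L[ℂ] H)) (hW.star_mul_op_mul x)
      simpa [mul_assoc, smul_mul_assoc] using this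
    rw [mul_assoc, h1, mul_smul_comm, mul_assoc (W : H →L[ℂ] H), ← mul_assoc b, hb x, ← mul_assoc,
      ← mul_assoc, hW x, smul_mul_assoc, smul_mul_assoc, smul_smul, circle_conj_mul_self, one_smul]
    simp only [mul_assoc]
  have h := ha _ hc
  have h2 := congrArg (fun T => star (W : H →L[ℂ] H) * T * W) h
  simp only [mul_assoc] at h2 ⊢
  rw [Unitary.coe_star_mul_self, mul_one, ← mul_assoc (star (W : H →L[ℂ] H)) (W : H →L[ℂ] H),
    Unitary.coe_star_mul_self, one_mul] at h2
  exact h2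

/-- Conjugation by a twisting unitary, as an automorphism of the bicommutant. -/
def Twists.conjHom (hW : π.Twists W η) : π.bicommutant →⋆ₐ[ℂ] π.bicommutant where
  toFun a := ⟨star (W : H →L[ℂ] H) * a * W, hW.conj_mem a.2⟩
  map_one' := by ext1; simp
  map_mul' a b := by
    ext1
    simp only [MulMemClass.coe_mul, mul_assoc]
    rw [← mul_assoc (W : H →L[ℂ] H) (star (W : H →L[ℂ] H)), Unitary.mul_star_self_of_mem W.2, one_mul]
  map_zero' := by ext1; simp
  map_add' a b := by ext1; simp [mul_add, add_mul]
  commutes' r := by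
    ext1
    change star (W : H →L[ℂ] H) * algebraMap ℂ (H →L[ℂ] H) r * W = algebraMap ℂ (H →L[ℂ] H) r
    rw [← Algebra.commutes, mul_assoc, Unitary.coe_star_mul_self, mul_one]
  map_star' a := by ext1; simp [mul_assoc]

lemma Twists.conjHom_coe (hW : π.Twists W η) (a : π.bicommutant) :
    (hW.conjHom a : H →L[ℂ] H) = star (W : H →L[ℂ] H) * a * W := rfl

lemma Twists.conjHom_opB (hW : π.Twists W η) (x : G) :
    hW.conjHom (π.opB x) = conj (η x : ℂ) • π.opB x :=
  Subtype.ext (hW.star_mul_op_mul x)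

variable [MeasurableSpace G] [BorelSpace G] (μ : Measure G) [μ.IsHaarMeasure]

lemma Twists.conjHom_integratedB_modulate (hW : π.Twists W η) (f : C_c(G, ℂ)) :
    hW.conjHom (π.integratedB μ (modulate η f)) = π.integratedB μ f := by
  refine Subtype.ext ?_
  rw [hW.conjHom_coe]
  ext v
  change star (W : H →L[ℂ] H) (∫ x, modulate η f x • π.op x ((W : H →L[ℂ] H) v) ∂μ) =
    ∫ x, f x • π.op x v ∂μ
  rw [← ContinuousLinearMap.integral_comp_comm _ (π.integrable_smul_op μ _ _)]
  refine integral_congr_ae (Eventually.of_forall fun x => ?_)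
  have h := congrArg (fun T : H →L[ℂ] H => T v) (hW.star_mul_op_mul x)
  simp only [mul_apply_eq_comp, _root_.smul_apply] at h
  simp only [map_smul, modulate_apply, h, smul_smul]
  rw [mul_right_comm, mul_comm (η x : ℂ), circle_conj_mul_self, one_mul]

variable [T2Space G] [LocallyCompactSpace G] [μ.Regular]

lemma Twists.comp_mem_finitePart (hW : π.Twists W η) {χ : characterSpace ℂ π.bicommutant}
    (hχ : χ ∈ π.finitePart μ) :
    CharacterSpace.compContinuousMap hW.conjHom χ ∈ π.finitePart μ := by
  obtain ⟨f, hf⟩ := hχ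
  refine ⟨modulate η f, ?_⟩
  change χ (hW.conjHom (π.integratedB μ (modulate η f))) ≠ 0
  rwa [hW.conjHom_integratedB_modulate μ]

lemma Twists.mem_finitePart_of_comp (hW : π.Twists W η) {χ : characterSpace ℂ π.bicommutant}
    (hχ : CharacterSpace.compContinuousMap hW.conjHom χ ∈ π.finitePart μ) :
    χ ∈ π.finitePart μ := by
  obtain ⟨f, hf⟩ := hχ
  refine ⟨modulate η⁻¹ f, ?_⟩
  have h : modulate η (modulate η⁻¹ f) = f := by
    ext x
    change (η x : ℂ) * (((η x)⁻¹ : Circle) * f x) = f x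
    rw [← mul_assoc, ← Circle.coe_mul, mul_inv_cancel, Circle.coe_one, one_mul]
  rw [← hW.conjHom_integratedB_modulate μ, h]
  exact hf

lemma Twists.dualPoint_comp (hW : π.Twists W η) {χ : characterSpace ℂ π.bicommutant}
    (hχ : χ ∈ π.finitePart μ) :
    π.dualPoint μ (CharacterSpace.compContinuousMap hW.conjHom χ) = π.dualPoint μ χ * η := by
  ext x
  have h1 := π.character_opB μ (hW.comp_mem_finitePart μ hχ) x
  have h2 : CharacterSpace.compContinuousMap hW.conjHom χ (π.opB x) =
      χ (hW.conjHom (π.opB x)) := rfl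
  rw [h2, hW.conjHom_opB, map_smul, π.character_opB μ hχ, smul_eq_mul, ← map_mul] at h1
  have h3 := (starRingEnd ℂ).injective h1
  rw [← h3, mul_comm]
  rfl

/-- A twisting unitary translates spectral measures. -/
lemma Twists.spectral_apply (hW : π.Twists W η) (v : H) {φ ψ : C_c(PontryaginDual G, ℝ)}
    (h : ∀ ξ, ψ ξ = φ (ξ * η)) :
    π.spectral μ ((W : H →L[ℂ] H) v) φ = π.spectral μ v ψ := by
  have key : hW.conjHom ((gelfandStarTransform π.bicommutant).symm (π.pullback μ φ)) =
      (gelfandStarTransform π.bicommutant).symm (π.pullback μ ψ) := by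
    apply EquivLike.injective (gelfandStarTransform π.bicommutant)
    rw [StarAlgEquiv.apply_symm_apply]
    ext χ
    rw [gelfandStarTransform_apply_apply]
    have h2 : χ (hW.conjHom ((gelfandStarTransform π.bicommutant).symm (π.pullback μ φ))) =
        π.pullback μ φ (CharacterSpace.compContinuousMap hW.conjHom χ) := by
      conv_rhs => rw [← StarAlgEquiv.apply_symm_apply (gelfandStarTransform π.bicommutant)
        (π.pullback μ φ)]
      rfl
    rw [h2, pullback_apply, pullback_apply]
    by_cases hχ : χ ∈ π.finitePart μ
    · rw [pullbackFun_of_mem _ _ _ hχ, pullbackFun_of_mem _ _ _ (hW.comp_mem_finitePart μ hχ),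
        hW.dualPoint_comp μ hχ, h]
    · rw [pullbackFun_of_notMem _ _ _ hχ,
        pullbackFun_of_notMem _ _ _ fun h' => hχ (hW.mem_finitePart_of_comp μ h')]
  have key2 := congrArg (fun a : π.bicommutant => (a : H →L[ℂ] H) v) key
  have e : inner ℂ ((W : H →L[ℂ] H) v) (π.ofGelfand (π.pullback μ φ) ((W : H →L[ℂ] H) v)) =
      inner ℂ v (π.ofGelfand (π.pullback μ ψ) v) := by
    rw [← ContinuousLinearMap.adjoint_inner_right, ← ContinuousLinearMap.star_eq_adjoint]
    exact congrArg (inner ℂ v) key2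
  rw [UnitaryRep.spectral_apply, UnitaryRep.spectral_apply, e]

end UnitaryRep

end

/-! ### The regular representation -/

section

variable {G : Type*} [CommGroup G] [TopologicalSpace G] [IsTopologicalGroup G]
  [T2Space G] [LocallyCompactSpace G] [MeasurableSpace G] [BorelSpace G]
  (μ : Measure G) [μ.IsHaarMeasure] [μ.Regular]

/-- Translation by a group element, as a linear isometry of `L²(G)`. -/
def translateL2 (x : G) : Lp ℂ 2 μ ≃ₗᵢ[ℂ] Lp ℂ 2 μ where
  toFun g := DomMulAct.mk x⁻¹ • g
  invFun g := DomMulAct.mk x • g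
  map_add' := smul_add _
  map_smul' c g := smul_comm _ c g
  left_inv g := by
    change DomMulAct.mk x • DomMulAct.mk x⁻¹ • g = g
    rw [← mul_smul, ← DomMulAct.mk_mul, inv_mul_cancel, DomMulAct.mk_one, one_smul]
  right_inv g := by
    change DomMulAct.mk x⁻¹ • DomMulAct.mk x • g = g
    rw [← mul_smul, ← DomMulAct.mk_mul, mul_inv_cancel, DomMulAct.mk_one, one_smul]
  norm_map' g := DomMulAct.norm_smul_Lp _ g

lemma translateL2_apply (x : G) (g : Lp ℂ 2 μ) :
    translateL2 μ x g = DomMulAct.mk x⁻¹ • g := rfl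

/-- The regular representation of `G` on `L²(G)`. -/
def regularRep : UnitaryRep G (Lp ℂ 2 μ) where
  toHom := (Unitary.linearIsometryEquiv (𝕜 := ℂ) (H := Lp ℂ 2 μ)).symm.toMonoidHom.comp
    { toFun := translateL2 μ
      map_one' := by
        ext1 g
        rw [translateL2_apply, inv_one, DomMulAct.mk_one, one_smul]
        rfl
      map_mul' := fun x y => by
        ext1 g
        change _ = translateL2 μ x (translateL2 μ y g)
        rw [translateL2_apply, translateL2_apply, translateL2_apply, ← mul_smul,
          ← DomMulAct.mk_mul, mul_inv_rev] }
  continuous_apply v := by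
    have : Fact ((2 : ℝ≥0∞) ≠ ∞) := ⟨by simp⟩
    exact (DomMulAct.mkHomeomorph.continuous.comp continuous_inv).smul continuous_const

lemma regularRep_op_apply (x : G) (g : Lp ℂ 2 μ) :
    (regularRep μ).op x g = DomMulAct.mk x⁻¹ • g := rfl

lemma memLp_of_compactlySupported (f : C_c(G, ℂ)) (p : ℝ≥0∞) : MemLp f p μ :=
  f.continuous.memLp_of_hasCompactSupport f.hasCompactSupport

/-- The class in `L²` of a compactly supported continuous function. -/
def toL2 (f : C_c(G, ℂ)) : Lp ℂ 2 μ := (memLp_of_compactlySupported μ f 2).toLp f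

lemma coeFn_toL2 (f : C_c(G, ℂ)) : toL2 μ f =ᵐ[μ] f := MemLp.coeFn_toLp _

lemma regularRep_op_toL2 (x : G) (f : C_c(G, ℂ)) :
    (regularRep μ).op x (toL2 μ f) = toL2 μ (UnitaryRep.translate x f) := rfl

lemma inner_toL2 (f g : C_c(G, ℂ)) :
    inner ℂ (toL2 μ f) (toL2 μ g) = ∫ y, g y * conj (f y) ∂μ := by
  rw [L2.inner_def]
  refine integral_congr_ae ?_
  filter_upwards [coeFn_toL2 μ f, coeFn_toL2 μ g] with y h1 h2
  rw [h1, h2, RCLike.inner_apply]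

/-- Density of compactly supported continuous functions in `L^p`. The version in Mathlib assumes
a normal space; here the approximation of compact sets uses local compactness instead. -/
lemma exists_compactlySupported_eLpNorm_sub_le {X : Type*} [TopologicalSpace X] [T2Space X]
    [LocallyCompactSpace X] [MeasurableSpace X] [BorelSpace X] (μ : Measure X) [μ.Regular]
    {p : ℝ≥0∞} (hp : p ≠ ∞) {f : X → ℂ} (hf : MemLp f p μ) {ε : ℝ≥0∞} (hε : ε ≠ 0) :
    ∃ g : C_c(X, ℂ), eLpNorm (f - ⇑g) p μ ≤ ε := by
  suffices H : ∃ g : X → ℂ, eLpNorm (f - g) p μ ≤ ε ∧ Continuous g ∧ HasCompactSupport g by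
    obtain ⟨g, hg, hgc, hgs⟩ := H
    exact ⟨⟨⟨g, hgc⟩, hgs⟩, hg⟩
  apply hf.induction_dense hp _ _ _ _ hε
  rotate_left
  · rintro f g ⟨f_cont, hf⟩ ⟨g_cont, hg⟩
    exact ⟨f_cont.add g_cont, hf.add hg⟩
  · rintro f ⟨f_cont, hf⟩
    have hm : MemLp f p μ := f_cont.memLp_of_hasCompactSupport hf
    exact hm.aestronglyMeasurable
  intro c t ht htμ ε hε
  obtain ⟨δ, δpos, hδ⟩ := exists_Lp_half ℂ μ p hε
  obtain ⟨η, ηpos, hη⟩ := exists_eLpNorm_indicator_le (μ := μ) hp c δpos.ne'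
  have hη0 : (η : ℝ≥0∞) ≠ 0 := ENNReal.coe_ne_zero.2 ηpos.ne'
  obtain ⟨s, st, hs, μs⟩ := ht.exists_isCompact_sdiff_lt htμ.ne hη0
  obtain ⟨V, sV, hV, -, μV⟩ := hs.measurableSet.exists_isOpen_sdiff_lt (hs.measure_lt_top (μ := μ)).ne hη0
  obtain ⟨g, g1, g0, gc, g01⟩ := exists_continuous_one_zero_of_isCompact hs hV.isClosed_compl
    (Set.disjoint_compl_right_iff_subset.2 sV)
  have hgc : Continuous fun x => g x • c := by fun_prop
  have I1 : eLpNorm ((s.indicator fun _ => c) - t.indicator fun _ => c) p μ ≤ δ := by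
    rw [← eLpNorm_neg, neg_sub, ← Set.indicator_sdiff st]
    exact hη _ μs.le
  have I2 : eLpNorm ((fun x => g x • c) - s.indicator fun _ => c) p μ ≤ δ := by
    refine (eLpNorm_mono (g := (V \ s).indicator fun _ => c) fun x => ?_).trans (hη _ μV.le)
    by_cases hxs : x ∈ s
    · simp [hxs, g1 hxs]
    by_cases hxV : x ∈ V
    · simp only [Pi.sub_apply, hxs, not_false_eq_true, Set.indicator_of_notMem, sub_zero, norm_smul,
        Set.mem_sdiff, hxV, and_self, Set.indicator_of_mem]
      rw [Real.norm_of_nonneg (g01 x).1]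
      exact mul_le_of_le_one_left (norm_nonneg _) (g01 x).2
    · simp [hxs, hxV, g0 (show x ∈ Vᶜ from hxV)]
  refine ⟨fun x => g x • c, ?_, hgc, gc.smul_right⟩
  have hI : (fun x => g x • c) - t.indicator (fun _ => c) =
      ((fun x => g x • c) - s.indicator fun _ => c) +
        ((s.indicator fun _ => c) - t.indicator fun _ => c) := by abel
  rw [hI]
  have hm : MemLp (fun x => g x • c) p μ := hgc.memLp_of_hasCompactSupport gc.smul_right
  exact (hδ _ _ (hm.aestronglyMeasurable.sub
    (aestronglyMeasurable_const.indicator hs.measurableSet))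
    ((aestronglyMeasurable_const.indicator hs.measurableSet).sub
      (aestronglyMeasurable_const.indicator ht)) I2 I1).le

lemma eq_of_forall_inner_toL2 {v w : Lp ℂ 2 μ}
    (h : ∀ φ : C_c(G, ℂ), inner ℂ (toL2 μ φ) v = inner ℂ (toL2 μ φ) w) : v = w := by
  have hd : DenseRange (toL2 μ) := by
    refine Metric.dense_iff.2 fun u r hr => ?_
    obtain ⟨f, hf⟩ := exists_compactlySupported_eLpNorm_sub_le μ (by simp) (Lp.memLp u)
      (ε := ENNReal.ofReal (r / 2)) (by simpa using hr)
    refine ⟨toL2 μ f, ?_, Set.mem_range_self _⟩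
    have h1 : eLpNorm (⇑u - ⇑(toL2 μ f)) 2 μ ≤ ENNReal.ofReal (r / 2) := by
      refine le_trans (le_of_eq (eLpNorm_congr_ae ?_)) hf
      filter_upwards [coeFn_toL2 μ f] with y h2
      rw [Pi.sub_apply, h2]
      rfl
    rw [Metric.mem_ball, dist_comm, Lp.dist_def]
    exact (ENNReal.toReal_le_of_le_ofReal (by positivity) h1).trans_lt (by linarith)
  exact hd.eq_of_inner_right ℂ h

lemma inner_toL2_integrated (φ f g : C_c(G, ℂ)) :
    inner ℂ (toL2 μ φ) ((regularRep μ).integrated μ f (toL2 μ g)) =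
      ∫ y, (∫ x, f x * g (x⁻¹ * y) ∂μ) * conj (φ y) ∂μ := by
  have h1 : inner ℂ (toL2 μ φ) ((regularRep μ).integrated μ f (toL2 μ g)) =
      ∫ x, ∫ y, f x * g (x⁻¹ * y) * conj (φ y) ∂μ ∂μ := by
    rw [UnitaryRep.integrated_apply]
    refine ((innerSL ℂ (toL2 μ φ)).integral_comp_comm
      ((regularRep μ).integrable_smul_op μ f (toL2 μ g))).symm.trans ?_
    refine integral_congr_ae (Eventually.of_forall fun x => ?_)
    simp only [innerSL_apply_apply, inner_smul_right]
    rw [regularRep_op_toL2, inner_toL2, ← integral_const_mul]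
    simp only [UnitaryRep.translate_apply, mul_assoc]
  rw [h1, integral_integral_swap_of_hasCompactSupport]
  · simp_rw [integral_mul_const]
  · have h2 : Continuous fun q : G × G => f q.1 * g (q.1⁻¹ * q.2) * conj (φ q.2) :=
      ((f.continuous.comp continuous_fst).mul (g.continuous.comp (by fun_prop))).mul
        (Complex.continuous_conj.comp (φ.continuous.comp continuous_snd))
    exact h2
  · refine HasCompactSupport.intro
      (f.hasCompactSupport.isCompact.prod φ.hasCompactSupport.isCompact) fun q hq => ?_
    rw [Set.mem_prod, not_and_or] at hq
    rcases hq with hq | hq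
    · simp [Function.uncurry, image_eq_zero_of_notMem_tsupport hq]
    · simp [Function.uncurry, image_eq_zero_of_notMem_tsupport hq]

/-- Commutativity of convolution. -/
lemma integrated_toL2_comm (f g : C_c(G, ℂ)) :
    (regularRep μ).integrated μ f (toL2 μ g) = (regularRep μ).integrated μ g (toL2 μ f) := by
  refine eq_of_forall_inner_toL2 μ fun φ => ?_
  rw [inner_toL2_integrated, inner_toL2_integrated]
  congr 1
  ext y
  congr 1
  rw [← integral_div_left_eq_self _ μ y]
  congr 1
  ext x
  rw [mul_comm, div_eq_mul_inv, mul_inv_rev, inv_inv, mul_assoc, mul_left_comm x, mul_comm x⁻¹ y]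
  simp [mul_comm]

lemma norm_dual_apply (η : PontryaginDual G) (x : G) : ‖(η x : ℂ)‖ = 1 := Circle.norm_coe _

lemma continuous_dual_apply (η : PontryaginDual G) : Continuous fun x => (η x : ℂ) :=
  continuous_subtype_val.comp (map_continuous η)

lemma memLp_dual_mul (η : PontryaginDual G) {f : G → ℂ} {p : ℝ≥0∞} (hf : MemLp f p μ) :
    MemLp (fun x => (η x : ℂ) * f x) p μ := by
  refine hf.of_le (AEStronglyMeasurable.mul ?_ hf.1) (Eventually.of_forall fun x => ?_)
  · exact ((continuous_dual_apply η).measurable).aestronglyMeasurable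
  · rw [norm_mul, norm_dual_apply, one_mul]

/-- Multiplication by a character on `L²(G)`. -/
def modulateL2 (η : PontryaginDual G) (g : Lp ℂ 2 μ) : Lp ℂ 2 μ :=
  (memLp_dual_mul μ η (Lp.memLp g)).toLp _

lemma coeFn_modulateL2 (η : PontryaginDual G) (g : Lp ℂ 2 μ) :
    modulateL2 μ η g =ᵐ[μ] fun x => (η x : ℂ) * g x := MemLp.coeFn_toLp _

lemma modulateL2_mul (η θ : PontryaginDual G) (g : Lp ℂ 2 μ) :
    modulateL2 μ η (modulateL2 μ θ g) = modulateL2 μ (η * θ) g := by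
  refine Lp.ext ?_
  filter_upwards [coeFn_modulateL2 μ η (modulateL2 μ θ g), coeFn_modulateL2 μ θ g,
    coeFn_modulateL2 μ (η * θ) g] with x h1 h2 h3
  rw [h1, h2, h3, ← mul_assoc]
  rfl

lemma modulateL2_one (g : Lp ℂ 2 μ) : modulateL2 μ 1 g = g := by
  refine Lp.ext ?_
  filter_upwards [coeFn_modulateL2 μ 1 g] with x h1
  rw [h1, PontryaginDual.one_apply, Circle.coe_one, one_mul]

/-- Multiplication by a character, as a unitary operator on `L²(G)`. -/
def modulateEquiv (η : PontryaginDual G) : Lp ℂ 2 μ ≃ₗᵢ[ℂ] Lp ℂ 2 μ where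
  toFun := modulateL2 μ η
  invFun := modulateL2 μ η⁻¹
  map_add' f g := by
    refine Lp.ext ?_
    filter_upwards [coeFn_modulateL2 μ η (f + g), coeFn_modulateL2 μ η f, coeFn_modulateL2 μ η g,
      Lp.coeFn_add f g, Lp.coeFn_add (modulateL2 μ η f) (modulateL2 μ η g)] with x h1 h2 h3 h4 h5
    rw [h1, h5, Pi.add_apply, h2, h3, h4, Pi.add_apply, mul_add]
  map_smul' c f := by
    refine Lp.ext ?_
    filter_upwards [coeFn_modulateL2 μ η (c • f), coeFn_modulateL2 μ η f,
      Lp.coeFn_smul c f, Lp.coeFn_smul c (modulateL2 μ η f)] with x h1 h2 h3 h4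
    rw [h1, RingHom.id_apply, h4, Pi.smul_apply, h2, h3, Pi.smul_apply, smul_eq_mul, smul_eq_mul,
      mul_left_comm]
  left_inv g := by rw [modulateL2_mul, inv_mul_cancel, modulateL2_one]
  right_inv g := by rw [modulateL2_mul, mul_inv_cancel, modulateL2_one]
  norm_map' g := by
    change ‖modulateL2 μ η g‖ = ‖g‖
    rw [Lp.norm_def, Lp.norm_def]
    congr 1
    refine eLpNorm_congr_norm_ae ?_
    filter_upwards [coeFn_modulateL2 μ η g] with x h1
    rw [h1, norm_mul, norm_dual_apply, one_mul]

/-- Multiplication by a character, as an element of the unitary group of `L²(G)`. -/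
def modulateUnitary (η : PontryaginDual G) : unitary (Lp ℂ 2 μ →L[ℂ] Lp ℂ 2 μ) :=
  (Unitary.linearIsometryEquiv (𝕜 := ℂ) (H := Lp ℂ 2 μ)).symm (modulateEquiv μ η)

lemma modulateUnitary_apply (η : PontryaginDual G) (g : Lp ℂ 2 μ) :
    (modulateUnitary μ η : Lp ℂ 2 μ →L[ℂ] Lp ℂ 2 μ) g = modulateL2 μ η g := rfl

lemma modulateUnitary_toL2 (η : PontryaginDual G) (f : C_c(G, ℂ)) :
    (modulateUnitary μ η : Lp ℂ 2 μ →L[ℂ] Lp ℂ 2 μ) (toL2 μ f) = toL2 μ (modulate η f) := by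
  rw [modulateUnitary_apply]
  refine Lp.ext ?_
  filter_upwards [coeFn_modulateL2 μ η (toL2 μ f), coeFn_toL2 μ f, coeFn_toL2 μ (modulate η f)]
    with x h1 h2 h3
  rw [h1, h2, h3]
  rfl

lemma twists_modulateUnitary (η : PontryaginDual G) :
    (regularRep μ).Twists (modulateUnitary μ η) η := by
  intro x
  ext1 g
  rw [mul_apply_eq_comp, _root_.smul_apply, mul_apply_eq_comp, modulateUnitary_apply,
    modulateUnitary_apply, regularRep_op_apply, regularRep_op_apply]
  refine Lp.ext ?_
  have hq := (measurePreserving_smul x⁻¹ μ).quasiMeasurePreserving.ae (coeFn_modulateL2 μ η g)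
  filter_upwards [coeFn_modulateL2 μ η (DomMulAct.mk x⁻¹ • g),
    DomMulAct.smul_Lp_ae_eq (DomMulAct.mk x⁻¹) g,
    Lp.coeFn_smul (η x : ℂ) (DomMulAct.mk x⁻¹ • modulateL2 μ η g),
    DomMulAct.smul_Lp_ae_eq (DomMulAct.mk x⁻¹) (modulateL2 μ η g), hq] with y h1 h2 h3 h4 h5
  have hy : (η y : ℂ) = (η x : ℂ) * (η (x⁻¹ * y) : ℂ) := by
    rw [← Circle.coe_mul, ← map_mul, mul_inv_cancel_left]
  rw [h1, h2, h3, Pi.smul_apply, h4, Equiv.symm_apply_apply, h5, hy, mul_assoc]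
  rfl

end

/-! ### Spectral measures of the regular representation -/

section

/-- A Radon measure computes the integral of a continuous function, finite or not, from its
integrals over compact sets; no `σ`-finiteness is needed. -/
lemma lintegral_le_of_forall_isCompact {X : Type*} [TopologicalSpace X] [T2Space X]
    [MeasurableSpace X] [BorelSpace X] (ν : Measure X) [ν.Regular] {h : X → ℝ≥0}
    (hh : Continuous h) {B : ℝ≥0} (hB : ∀ C, IsCompact C → ∫⁻ x in C, h x ∂ν ≤ B) :
    ∫⁻ x, h x ∂ν ≤ B := by
  -- The truncation of `h` at height `N`, on the set where `h > 1 / (n + 1)`.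
  have main : ∀ n N : ℕ, ∫⁻ x in {x | (1 : ℝ≥0) / (n + 1) < h x}, (min (h x) N : ℝ≥0) ∂ν ≤ B := by
    intro n N
    set O := {x | (1 : ℝ≥0) / (n + 1) < h x} with hO
    have hOo : IsOpen O := isOpen_lt continuous_const hh
    have hOfin : ν O ≤ (n + 1) * B := by
      rw [hOo.measure_eq_iSup_isCompact]
      refine iSup₂_le fun C hCO => iSup_le fun hC => ?_
      have h1 : (((1 : ℝ≥0) / (n + 1) : ℝ≥0) : ℝ≥0∞) * ν C ≤ B := by
        rw [← setLIntegral_const]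
        refine (setLIntegral_mono hh.measurable.coe_nnreal_ennreal fun x hx => ?_).trans (hB C hC)
        exact ENNReal.coe_le_coe.2 (le_of_lt (hCO hx))
      have h2 : ((n : ℝ≥0∞) + 1) * (((1 : ℝ≥0) / (n + 1) : ℝ≥0) : ℝ≥0∞) = 1 := by
        have : ((n : ℝ≥0) + 1) * ((1 : ℝ≥0) / (n + 1)) = 1 := by field_simp
        exact_mod_cast congrArg ((↑) : ℝ≥0 → ℝ≥0∞) this
      calc ν C = ((n : ℝ≥0∞) + 1) * (((1 : ℝ≥0) / (n + 1) : ℝ≥0) * ν C) := by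
            rw [← mul_assoc, h2, one_mul]
        _ ≤ _ := by gcongr
    have hOtop : ν O ≠ ∞ := by
      refine ne_top_of_le_ne_top ?_ hOfin
      exact ENNReal.mul_ne_top (by simp) (by simp)
    refine ENNReal.le_of_forall_pos_le_add fun ε hε _ => ?_
    have hε' : (ε : ℝ≥0∞) / (N + 1) ≠ 0 := by
      simp [ENNReal.div_eq_zero_iff, hε.ne']
    obtain ⟨C, hCO, hC, hlt⟩ := hOo.measurableSet.exists_isCompact_sdiff_lt hOtop hε'
    have hm : Measurable fun x => ((min (h x) N : ℝ≥0) : ℝ≥0∞) :=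
      (hh.min continuous_const).measurable.coe_nnreal_ennreal
    rw [← lintegral_inter_add_sdiff (μ := ν) (fun x => ((min (h x) N : ℝ≥0) : ℝ≥0∞)) O
      hC.measurableSet, Set.inter_eq_right.2 hCO]
    refine add_le_add ((lintegral_mono fun x => ?_).trans (hB C hC)) ?_
    · exact ENNReal.coe_le_coe.2 (min_le_left _ _)
    · calc ∫⁻ x in O \ C, ((min (h x) N : ℝ≥0) : ℝ≥0∞) ∂ν ≤ ∫⁻ x in O \ C, (N + 1 : ℝ≥0∞) ∂ν := by
            refine lintegral_mono fun x => ?_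
            refine (ENNReal.coe_le_coe.2 (min_le_right (h x) N)).trans ?_
            simp
        _ = (N + 1) * ν (O \ C) := setLIntegral_const _ _
        _ ≤ (N + 1) * (ε / (N + 1)) := by gcongr
        _ = ε := ENNReal.mul_div_cancel (by simp) (by simp)
  have hsup : ∀ x, ((h x : ℝ≥0) : ℝ≥0∞) = ⨆ n : ℕ, ({x | (1 : ℝ≥0) / (n + 1) < h x}).indicator
      (fun x => ((min (h x) n : ℝ≥0) : ℝ≥0∞)) x := by
    intro x
    refine le_antisymm ?_ (iSup_le fun n => Set.indicator_le_self' (fun _ _ => zero_le) x |>.trans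
      (ENNReal.coe_le_coe.2 (min_le_left _ _)))
    rcases eq_or_ne (h x) 0 with h0 | h0
    · simp [h0]
    obtain ⟨n₁, hn₁⟩ := exists_nat_gt (h x)
    obtain ⟨n₂, hn₂⟩ := exists_nat_gt (1 / h x)
    refine le_iSup_of_le (max n₁ n₂) ?_
    have hpos : 0 < h x := pos_iff_ne_zero.2 h0
    have hmem : (1 : ℝ≥0) / ((max n₁ n₂ : ℕ) + 1) < h x := by
      rw [div_lt_iff₀ (by positivity)]
      rw [div_lt_iff₀ hpos] at hn₂
      refine hn₂.trans_le ?_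
      rw [mul_comm]
      gcongr
      push_cast
      exact (le_max_right _ _).trans (le_add_of_nonneg_right zero_le_one)
    rw [Set.indicator_of_mem (show x ∈ {x | (1 : ℝ≥0) / ((max n₁ n₂ : ℕ) + 1) < h x} from hmem)]
    refine ENNReal.coe_le_coe.2 (le_min le_rfl (hn₁.le.trans ?_))
    push_cast
    exact le_max_left _ _
  have hmeas : ∀ n : ℕ, MeasurableSet {x | (1 : ℝ≥0) / (n + 1) < h x} := fun n =>
    (isOpen_lt continuous_const hh).measurableSet
  simp_rw [hsup]
  rw [lintegral_iSup]
  · refine iSup_le fun n => ?_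
    rw [lintegral_indicator (hmeas n)]
    exact main n n
  · exact fun n => (hh.min continuous_const).measurable.coe_nnreal_ennreal.indicator (hmeas n)
  · intro n k hnk x
    have hsub : {x | (1 : ℝ≥0) / (n + 1) < h x} ⊆ {x | (1 : ℝ≥0) / (k + 1) < h x} := by
      intro x hx
      refine lt_of_le_of_lt ?_ (show (1 : ℝ≥0) / (n + 1) < h x from hx)
      gcongr
    refine (Set.indicator_le_indicator_of_subset hsub (fun _ => zero_le) x).trans ?_
    refine Set.indicator_le_indicator (ENNReal.coe_le_coe.2 (min_le_min le_rfl ?_))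
    exact_mod_cast hnk

section Plancherel

variable {G : Type*} [CommGroup G] [TopologicalSpace G] [IsTopologicalGroup G]
  [T2Space G] [LocallyCompactSpace G] [MeasurableSpace G] [BorelSpace G]
  (μ : Measure G) [μ.IsHaarMeasure] [μ.Regular]

lemma scalarFourier_modulate (η : PontryaginDual G) (f : C_c(G, ℂ)) (ξ : PontryaginDual G) :
    scalarFourier μ (modulate η f) ξ = scalarFourier μ f (ξ * η⁻¹) := by
  refine integral_congr_ae (Eventually.of_forall fun x => ?_)
  change conj (ξ x : ℂ) * ((η x : ℂ) * f x) = conj (((ξ x) * (η x)⁻¹ : Circle) : ℂ) * f x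
  rw [Circle.coe_mul, Circle.coe_inv_eq_conj, map_mul, Complex.conj_conj, mul_assoc]

lemma hasCompactSupport_mul_normSq (f : C_c(G, ℂ)) (φ : C_c(PontryaginDual G, ℝ)) :
    HasCompactSupport fun ξ => φ ξ * ‖scalarFourier μ f ξ‖ ^ 2 := by
  refine HasCompactSupport.intro φ.hasCompactSupport.isCompact fun ξ hξ => ?_
  rw [image_eq_zero_of_notMem_tsupport hξ, zero_mul]

lemma continuous_mul_normSq (f : C_c(G, ℂ)) (φ : C_c(PontryaginDual G, ℝ)) :
    Continuous fun ξ => φ ξ * ‖scalarFourier μ f ξ‖ ^ 2 :=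
  φ.continuous.mul ((continuous_scalarFourier μ f).norm.pow 2)

/-- The product of a compactly supported function with `|f̂|²`. -/
def mulNormSq (f : C_c(G, ℂ)) (φ : C_c(PontryaginDual G, ℝ)) : C_c(PontryaginDual G, ℝ) :=
  ⟨⟨fun ξ => φ ξ * ‖scalarFourier μ f ξ‖ ^ 2, continuous_mul_normSq μ f φ⟩,
    hasCompactSupport_mul_normSq μ f φ⟩

/-- The spectral functional of a compactly supported function in the regular representation. -/
def spectralCc (f : C_c(G, ℂ)) : C_c(PontryaginDual G, ℝ) →ₚ[ℝ] ℝ :=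
  (regularRep μ).spectral μ (toL2 μ f)

/-- The relation `|f̂|² M_g = |ĝ|² M_f` between spectral measures, from commutativity of
convolution. -/
lemma spectralCc_mulNormSq (f g : C_c(G, ℂ)) (φ : C_c(PontryaginDual G, ℝ)) :
    spectralCc μ g (mulNormSq μ f φ) = spectralCc μ f (mulNormSq μ g φ) := by
  rw [spectralCc, spectralCc, ← UnitaryRep.spectral_integrated _ μ f (toL2 μ g) (φ := φ)
    (fun ξ => rfl), integrated_toL2_comm, UnitaryRep.spectral_integrated _ μ g (toL2 μ f)
    (φ := φ) (ψ := mulNormSq μ g φ) (fun ξ => rfl)]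

lemma spectralCc_modulate (η : PontryaginDual G) (f : C_c(G, ℂ)) {φ ψ : C_c(PontryaginDual G, ℝ)}
    (h : ∀ ξ, ψ ξ = φ (ξ * η)) : spectralCc μ (modulate η f) φ = spectralCc μ f ψ := by
  rw [spectralCc, ← modulateUnitary_toL2]
  exact (twists_modulateUnitary μ η).spectral_apply μ _ h

/-- The product of `φ` with the translate of `ψ` by `η`. -/
def mulTranslate (η : PontryaginDual G) (φ ψ : C_c(PontryaginDual G, ℝ)) :
    C_c(PontryaginDual G, ℝ) where
  toFun ξ := φ ξ * ψ (ξ * η⁻¹)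
  continuous_toFun := φ.continuous.mul (ψ.continuous.comp (continuous_mul_const _))
  hasCompactSupport' := φ.hasCompactSupport.mul_right

variable [MeasurableSpace (PontryaginDual G)] [BorelSpace (PontryaginDual G)]
  (ν : Measure (PontryaginDual G)) [ν.IsHaarMeasure] [ν.Regular]

/-- The spectral measure `M_f` on the dual group. -/
def spectralMeasure (f : C_c(G, ℂ)) : Measure (PontryaginDual G) :=
  RealRMK.rieszMeasure (spectralCc μ f)

lemma integral_spectralMeasure (f : C_c(G, ℂ)) (φ : C_c(PontryaginDual G, ℝ)) :
    ∫ ξ, φ ξ ∂(spectralMeasure μ f) = spectralCc μ f φ :=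
  RealRMK.integral_rieszMeasure _ φ

instance (f : C_c(G, ℂ)) : (spectralMeasure μ f).Regular :=
  inferInstanceAs (RealRMK.rieszMeasure (spectralCc μ f)).Regular

/-- The relation `spectralCc_mulNormSq` for a function multiplied by a character. -/
lemma integral_translate_eq (f g : C_c(G, ℂ)) (φ ψ : C_c(PontryaginDual G, ℝ))
    (η : PontryaginDual G) :
    ∫ ξ, φ ξ * mulNormSq μ f ψ (ξ * η⁻¹) ∂(spectralMeasure μ g) =
      ∫ ξ, mulNormSq μ g φ (ξ * η) * ψ ξ ∂(spectralMeasure μ f) := by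
  have h := spectralCc_mulNormSq μ (modulate η f) g (mulTranslate η φ ψ)
  let χ : C_c(PontryaginDual G, ℝ) :=
    ⟨⟨fun ξ => mulNormSq μ g φ (ξ * η) * ψ ξ, ((mulNormSq μ g φ).continuous.comp
      (continuous_mul_const _)).mul ψ.continuous⟩, ψ.hasCompactSupport.mul_left⟩
  rw [spectralCc_modulate μ η f (ψ := χ), ← integral_spectralMeasure,
    ← integral_spectralMeasure] at h
  · refine Eq.trans (integral_congr_ae (Eventually.of_forall fun ξ => ?_)) h
    change φ ξ * (ψ (ξ * η⁻¹) * ‖scalarFourier μ f (ξ * η⁻¹)‖ ^ 2) =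
      φ ξ * ψ (ξ * η⁻¹) * ‖scalarFourier μ (modulate η f) ξ‖ ^ 2
    rw [scalarFourier_modulate, mul_assoc]
  · intro ξ
    change φ (ξ * η) * ‖scalarFourier μ g (ξ * η)‖ ^ 2 * ψ ξ =
      φ (ξ * η) * ψ (ξ * η * η⁻¹) * ‖scalarFourier μ g (ξ * η)‖ ^ 2
    rw [mul_inv_cancel_right]
    ring

/-- All spectral measures have densities `|f̂|²` with respect to Haar measure, up to one constant:
the relation between spectral measures is averaged over the dual group. -/
lemma spectralCc_mul_integral (f g : C_c(G, ℂ)) (φ ψ : C_c(PontryaginDual G, ℝ)) :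
    spectralCc μ g φ * ∫ ξ, mulNormSq μ f ψ ξ ∂ν =
      spectralCc μ f ψ * ∫ ξ, mulNormSq μ g φ ξ ∂ν := by
  have h1 : ∫ η, ∫ ξ, φ ξ * mulNormSq μ f ψ (ξ * η⁻¹) ∂(spectralMeasure μ g) ∂ν =
      spectralCc μ g φ * ∫ ξ, mulNormSq μ f ψ ξ ∂ν := by
    rw [integral_integral_swap_of_hasCompactSupport]
    · simp_rw [integral_const_mul]
      have : ∀ ξ, ∫ η, mulNormSq μ f ψ (ξ * η⁻¹) ∂ν = ∫ η, mulNormSq μ f ψ η ∂ν := fun ξ => by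
        simp_rw [← div_eq_mul_inv]
        exact integral_div_left_eq_self _ ν ξ
      simp_rw [this]
      rw [integral_mul_const, integral_spectralMeasure]
    · exact (φ.continuous.comp continuous_snd).mul ((mulNormSq μ f ψ).continuous.comp
        (continuous_snd.mul continuous_fst.inv))
    · have hK := ((φ.hasCompactSupport.isCompact.prod
        (mulNormSq μ f ψ).hasCompactSupport.isCompact)).image
          (f := fun q : PontryaginDual G × PontryaginDual G => (q.2⁻¹ * q.1, q.1)) (by fun_prop)
      refine HasCompactSupport.intro hK fun q hq => ?_
      by_contra hne
      refine hq ⟨(q.2, q.2 * q.1⁻¹), ⟨subset_tsupport _ fun h => hne ?_,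
        subset_tsupport _ fun h => hne ?_⟩, by ext1 <;> simp⟩
      · simp only [Function.uncurry, h, zero_mul]
      · simp only [Function.uncurry, h, mul_zero]
  have h2 : ∫ η, ∫ ξ, mulNormSq μ g φ (ξ * η) * ψ ξ ∂(spectralMeasure μ f) ∂ν =
      spectralCc μ f ψ * ∫ ξ, mulNormSq μ g φ ξ ∂ν := by
    rw [integral_integral_swap_of_hasCompactSupport]
    · simp_rw [integral_mul_const, integral_mul_left_eq_self]
      rw [integral_const_mul, integral_spectralMeasure, mul_comm]
    · exact ((mulNormSq μ g φ).continuous.comp (continuous_snd.mul continuous_fst)).mul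
        (ψ.continuous.comp continuous_snd)
    · have hK := (((mulNormSq μ g φ).hasCompactSupport.isCompact.prod
        ψ.hasCompactSupport.isCompact)).image
          (f := fun q : PontryaginDual G × PontryaginDual G => (q.2⁻¹ * q.1, q.2)) (by fun_prop)
      refine HasCompactSupport.intro hK fun q hq => ?_
      by_contra hne
      refine hq ⟨(q.2 * q.1, q.2), ⟨subset_tsupport _ fun h => hne ?_,
        subset_tsupport _ fun h => hne ?_⟩, by ext1 <;> simp⟩
      · simp only [Function.uncurry, h, zero_mul]
      · simp only [Function.uncurry, h, mul_zero]
  rw [← h1, ← h2]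
  simp_rw [integral_translate_eq]

end Plancherel

end

/-! ### The Plancherel theorem for continuous functions of compact support -/

section

variable {G : Type*} [CommGroup G] [TopologicalSpace G] [IsTopologicalGroup G]
  [T2Space G] [LocallyCompactSpace G] [MeasurableSpace G] [BorelSpace G]
  (μ : Measure G) [μ.IsHaarMeasure] [μ.Regular]

lemma scalarFourier_congr_ae {f g : G → ℂ} (h : f =ᵐ[μ] g) (ξ : PontryaginDual G) :
    scalarFourier μ f ξ = scalarFourier μ g ξ := by
  refine integral_congr_ae ?_
  filter_upwards [h] with x hx
  rw [hx]

lemma integrable_conj_mul {f : G → ℂ} (hf : Integrable f μ) (ξ : PontryaginDual G) :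
    Integrable (fun x => conj (ξ x : ℂ) * f x) μ := by
  refine hf.mono (AEStronglyMeasurable.mul ?_ hf.1) (Eventually.of_forall fun x => ?_)
  · exact (Complex.continuous_conj.comp (continuous_dual_apply ξ)).measurable.aestronglyMeasurable
  · rw [norm_mul, RCLike.norm_conj, norm_dual_apply, one_mul]

lemma scalarFourier_sub {f g : G → ℂ} (hf : Integrable f μ) (hg : Integrable g μ)
    (ξ : PontryaginDual G) :
    scalarFourier μ (f - g) ξ = scalarFourier μ f ξ - scalarFourier μ g ξ := by
  simp only [scalarFourier, Pi.sub_apply, mul_sub]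
  exact integral_sub (integrable_conj_mul μ hf ξ) (integrable_conj_mul μ hg ξ)

lemma scalarFourier_add {f g : G → ℂ} (hf : Integrable f μ) (hg : Integrable g μ)
    (ξ : PontryaginDual G) :
    scalarFourier μ (f + g) ξ = scalarFourier μ f ξ + scalarFourier μ g ξ := by
  simp only [scalarFourier, Pi.add_apply, mul_add]
  exact integral_add (integrable_conj_mul μ hf ξ) (integrable_conj_mul μ hg ξ)

lemma scalarFourier_smul (c : ℂ) (f : G → ℂ) (ξ : PontryaginDual G) :
    scalarFourier μ (c • f) ξ = c * scalarFourier μ f ξ := by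
  simp only [scalarFourier, Pi.smul_apply, smul_eq_mul, mul_left_comm _ c]
  exact integral_const_mul _ _

lemma enorm_scalarFourier_le (f : G → ℂ) (ξ : PontryaginDual G) :
    ‖scalarFourier μ f ξ‖ₑ ≤ eLpNorm f 1 μ := by
  rw [eLpNorm_one_eq_lintegral_enorm]
  refine (enorm_integral_le_lintegral_enorm _).trans (le_of_eq (lintegral_congr fun x => ?_))
  rw [enorm_mul]
  have : ‖conj (ξ x : ℂ)‖ₑ = 1 := by
    rw [← ofReal_norm, RCLike.norm_conj, norm_dual_apply, ENNReal.ofReal_one]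
  rw [this, one_mul]

section Const

variable [MeasurableSpace (PontryaginDual G)] [BorelSpace (PontryaginDual G)]
  (ν : Measure (PontryaginDual G)) [ν.IsHaarMeasure] [ν.Regular]

/-- The Plancherel constant: spectral measures are `c |ĝ|² ν`. -/
lemma exists_spectralCc_eq : ∃ c : ℝ, 0 < c ∧ ∀ (g : C_c(G, ℂ)) (φ : C_c(PontryaginDual G, ℝ)),
    spectralCc μ g φ = c * ∫ ξ, mulNormSq μ g φ ξ ∂ν := by
  obtain ⟨f, hf⟩ := exists_le_norm_scalarFourier μ (isCompact_singleton (x := (1 : PontryaginDual G)))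
  have hf1 : scalarFourier μ f 1 ≠ 0 := by
    intro h
    have := hf 1 rfl
    rw [h, norm_zero] at this
    norm_num at this
  obtain ⟨ψ, hψ1, -, hψc, hψ⟩ := exists_continuous_one_zero_of_isCompact
    (isCompact_singleton (x := (1 : PontryaginDual G))) isClosed_empty (Set.disjoint_empty _)
  have hpos : 0 < ∫ ξ, mulNormSq μ f ⟨ψ, hψc⟩ ξ ∂ν := by
    refine (mulNormSq μ f ⟨ψ, hψc⟩).continuous.integral_pos_of_hasCompactSupport_nonneg_nonzero
      (mulNormSq μ f ⟨ψ, hψc⟩).hasCompactSupport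
      (fun ξ => mul_nonneg (hψ ξ).1 (sq_nonneg _)) (x := 1) ?_
    change ψ 1 * ‖scalarFourier μ f 1‖ ^ 2 ≠ 0
    rw [hψ1 rfl]
    simpa using hf1
  set c := spectralCc μ f ⟨ψ, hψc⟩ / ∫ ξ, mulNormSq μ f ⟨ψ, hψc⟩ ξ ∂ν with hc
  have hall : ∀ (g : C_c(G, ℂ)) (φ : C_c(PontryaginDual G, ℝ)),
      spectralCc μ g φ = c * ∫ ξ, mulNormSq μ g φ ξ ∂ν := fun g φ => by
    rw [hc, div_mul_eq_mul_div, eq_div_iff hpos.ne']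
    exact spectralCc_mul_integral μ ν f g φ ⟨ψ, hψc⟩
  have hc0 : 0 ≤ c := div_nonneg (map_nonneg (spectralCc μ f) fun ξ => (hψ ξ).1) hpos.le
  refine ⟨c, hc0.lt_of_ne fun h0 => hf1 ?_, hall⟩
  -- If the constant vanished, so would all spectral measures, hence `f` itself.
  have hn : ‖toL2 μ f‖ ^ 2 ≤ 0 := by
    refine le_of_forall_pos_le_add fun ε hε => ?_
    obtain ⟨φ, -, -, hφ⟩ := (regularRep μ).exists_sub_le_spectral μ (toL2 μ f) hε
    have := hall f φ
    rw [← h0, zero_mul] at this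
    rw [spectralCc] at this
    linarith
  have hz : toL2 μ f = 0 := by
    rw [← norm_eq_zero]
    exact pow_eq_zero_iff two_ne_zero |>.1 (le_antisymm hn (sq_nonneg _))
  have hae : (f : G → ℂ) =ᵐ[μ] fun _ => 0 := by
    filter_upwards [coeFn_toL2 μ f, Lp.coeFn_zero ℂ 2 μ] with x h1 h2
    rw [← h1, hz, h2]
    rfl
  rw [scalarFourier_congr_ae μ hae]
  simp [scalarFourier]

/-- Comparison of the total masses of `|ĝ|² ν` and of the spectral measure of `g`. -/
lemma lintegral_normSq_eq {c : ℝ} (hc : 0 < c)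
    (h : ∀ (g : C_c(G, ℂ)) (φ : C_c(PontryaginDual G, ℝ)),
      spectralCc μ g φ = c * ∫ ξ, mulNormSq μ g φ ξ ∂ν) (g : C_c(G, ℂ)) :
    ∫⁻ ξ, (‖scalarFourier μ g ξ‖₊ ^ 2 : ℝ≥0) ∂ν = ENNReal.ofReal (‖toL2 μ g‖ ^ 2 / c) := by
  have hcont : Continuous fun ξ => ‖scalarFourier μ g ξ‖₊ ^ 2 :=
    (continuous_scalarFourier μ g).nnnorm.pow 2
  have hint : ∀ φ : C_c(PontryaginDual G, ℝ), (∀ ξ, 0 ≤ φ ξ) →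
      ENNReal.ofReal (∫ ξ, mulNormSq μ g φ ξ ∂ν) =
        ∫⁻ ξ, ENNReal.ofReal (mulNormSq μ g φ ξ) ∂ν := fun φ hφ =>
    ofReal_integral_eq_lintegral_ofReal
      ((mulNormSq μ g φ).continuous.integrable_of_hasCompactSupport
        (mulNormSq μ g φ).hasCompactSupport)
      (Eventually.of_forall fun ξ => mul_nonneg (hφ ξ) (sq_nonneg _))
  have hsq : ∀ ξ, (((‖scalarFourier μ g ξ‖₊ ^ 2 : ℝ≥0)) : ℝ≥0∞) =
      ENNReal.ofReal (‖scalarFourier μ g ξ‖ ^ 2) := fun ξ => by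
    rw [← ENNReal.ofReal_coe_nnreal]
    simp
  refine le_antisymm ?_ ?_
  · refine lintegral_le_of_forall_isCompact ν hcont (B := (‖toL2 μ g‖ ^ 2 / c).toNNReal)
      fun C hC => ?_
    obtain ⟨φ, hφ1, -, hφc, hφ⟩ := exists_continuous_one_zero_of_isCompact hC isClosed_empty
      (Set.disjoint_empty _)
    calc ∫⁻ ξ in C, (‖scalarFourier μ g ξ‖₊ ^ 2 : ℝ≥0) ∂ν
        ≤ ∫⁻ ξ in C, ENNReal.ofReal (mulNormSq μ g ⟨φ, hφc⟩ ξ) ∂ν := by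
          refine setLIntegral_mono' hC.measurableSet fun ξ hξ => ?_
          rw [hsq]
          refine ENNReal.ofReal_le_ofReal (le_of_eq ?_)
          change _ = φ ξ * ‖scalarFourier μ g ξ‖ ^ 2
          rw [hφ1 hξ, Pi.one_apply, one_mul]
      _ ≤ ∫⁻ ξ, ENNReal.ofReal (mulNormSq μ g ⟨φ, hφc⟩ ξ) ∂ν := setLIntegral_le_lintegral _ _
      _ = ENNReal.ofReal (∫ ξ, mulNormSq μ g ⟨φ, hφc⟩ ξ ∂ν) := (hint _ fun ξ => (hφ ξ).1).symm
      _ ≤ ENNReal.ofReal (‖toL2 μ g‖ ^ 2 / c) := by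
          refine ENNReal.ofReal_le_ofReal ?_
          rw [le_div_iff₀ hc, mul_comm, ← h]
          exact (regularRep μ).spectral_le μ (toL2 μ g) fun ξ => (hφ ξ).2
  · refine ENNReal.le_of_forall_pos_le_add fun ε hε _ => ?_
    obtain ⟨φ, hφ0, hφ1, hφ⟩ := (regularRep μ).exists_sub_le_spectral μ (toL2 μ g)
      (mul_pos hc (NNReal.coe_pos.2 hε))
    have h1 : ‖toL2 μ g‖ ^ 2 / c ≤ ∫ ξ, mulNormSq μ g φ ξ ∂ν + ε := by
      rw [div_le_iff₀ hc, add_mul]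
      have := h g φ
      rw [spectralCc] at this
      rw [this] at hφ
      linarith
    refine (ENNReal.ofReal_le_ofReal h1).trans ?_
    refine ENNReal.ofReal_add_le.trans (add_le_add ?_ (by simp))
    rw [hint φ hφ0]
    refine lintegral_mono fun ξ => ?_
    rw [hsq]
    exact ENNReal.ofReal_le_ofReal (mul_le_of_le_one_left (sq_nonneg _) (hφ1 ξ))

lemma eLpNorm_two_sq {X E : Type*} [MeasurableSpace X] [NormedAddCommGroup E] (ν : Measure X)
    (f : X → E) : eLpNorm f 2 ν ^ 2 = ∫⁻ x, ‖f x‖ₑ ^ 2 ∂ν := by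
  have := eLpNorm_nnreal_pow_eq_lintegral (f := f) (μ := ν) (p := 2) two_ne_zero
  simpa using this

/-- The Plancherel theorem for compactly supported continuous functions; the constant depends on
the normalizations of the two Haar measures. -/
lemma exists_eLpNorm_scalarFourier_compactlySupported :
    ∃ c : ℝ≥0, c ≠ 0 ∧ ∀ g : C_c(G, ℂ), eLpNorm (scalarFourier μ g) 2 ν = c * eLpNorm g 2 μ := by
  obtain ⟨c, hc, h⟩ := exists_spectralCc_eq μ ν
  refine ⟨(Real.sqrt c⁻¹).toNNReal, by simpa using hc, fun g => ?_⟩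
  have h1 := lintegral_normSq_eq μ ν hc h g
  have h2 : eLpNorm (scalarFourier μ g) 2 ν ^ 2 =
      (((Real.sqrt c⁻¹).toNNReal : ℝ≥0∞) * eLpNorm g 2 μ) ^ 2 := by
    have h3 : eLpNorm g 2 μ = ENNReal.ofReal ‖toL2 μ g‖ := by
      rw [toL2, Lp.norm_toLp, ENNReal.ofReal_toReal (memLp_of_compactlySupported μ g 2).2.ne]
    rw [eLpNorm_two_sq, h3]
    change _ = (ENNReal.ofReal _ * _) ^ 2
    rw [← ENNReal.ofReal_mul (Real.sqrt_nonneg _), ← ENNReal.ofReal_pow (by positivity), mul_pow,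
      Real.sq_sqrt (by positivity), inv_mul_eq_div, ← h1]
    refine lintegral_congr fun ξ => ?_
    rw [ENNReal.coe_pow]
    rfl
  exact (ENNReal.pow_right_strictMono two_ne_zero).injective h2

end Const

end

/-! ### The Plancherel theorem and Parseval's formula on `L²` -/

section

/-- On a set of finite measure the `L¹` norm is bounded by the `L²` norm. -/
lemma eLpNorm_one_le_of_ae_eq_zero {X E : Type*} [MeasurableSpace X] [NormedAddCommGroup E]
    {μ : Measure X} {K : Set X} (hK : MeasurableSet K) {f : X → E}
    (hf : AEStronglyMeasurable f μ) (h0 : ∀ᵐ x ∂μ, x ∉ K → f x = 0) :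
    eLpNorm f 1 μ ≤ eLpNorm f 2 μ * μ K ^ (1 / 2 : ℝ) := by
  have h : f =ᵐ[μ] K.indicator f := by
    filter_upwards [h0] with x hx
    by_cases hxK : x ∈ K
    · rw [Set.indicator_of_mem hxK]
    · rw [Set.indicator_of_notMem hxK, hx hxK]
  rw [eLpNorm_congr_ae h, eLpNorm_indicator_eq_eLpNorm_restrict hK]
  refine (eLpNorm_le_eLpNorm_mul_rpow_measure_univ (p := 1) (q := 2) (by norm_num)
    hf.restrict).trans ?_
  rw [Measure.restrict_apply_univ]
  refine mul_le_mul' (eLpNorm_mono_measure _ Measure.restrict_le_self) (le_of_eq ?_)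
  norm_num

/-- Square integrable scalar functions that vanish almost everywhere outside `K`. -/
structure MemL2On {G : Type*} [MeasurableSpace G] (μ : Measure G) (K : Set G) (f : G → ℂ) :
    Prop where
  memLp : MemLp f 2 μ
  ae_eq_zero : ∀ᵐ x ∂μ, x ∉ K → f x = 0

namespace MemL2On

variable {G : Type*} [MeasurableSpace G] {μ : Measure G} {K : Set G} {f g : G → ℂ}

lemma sub (hf : MemL2On μ K f) (hg : MemL2On μ K g) : MemL2On μ K (f - g) :=
  ⟨hf.1.sub hg.1, by
    filter_upwards [hf.2, hg.2] with x h1 h2 hx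
    rw [Pi.sub_apply, h1 hx, h2 hx, sub_zero]⟩

lemma add (hf : MemL2On μ K f) (hg : MemL2On μ K g) : MemL2On μ K (f + g) :=
  ⟨hf.1.add hg.1, by
    filter_upwards [hf.2, hg.2] with x h1 h2 hx
    rw [Pi.add_apply, h1 hx, h2 hx, add_zero]⟩

lemma smul (c : ℂ) (hf : MemL2On μ K f) : MemL2On μ K (c • f) :=
  ⟨hf.1.const_smul c, by
    filter_upwards [hf.2] with x h1 hx
    rw [Pi.smul_apply, h1 hx, smul_zero]⟩

lemma mono {L : Set G} (h : K ⊆ L) (hf : MemL2On μ K f) : MemL2On μ L f :=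
  ⟨hf.1, hf.2.mono fun _ hx hL => hx fun hK => hL (h hK)⟩

lemma eLpNorm_one_le (hK : MeasurableSet K) (hf : MemL2On μ K f) :
    eLpNorm f 1 μ ≤ eLpNorm f 2 μ * μ K ^ (1 / 2 : ℝ) :=
  eLpNorm_one_le_of_ae_eq_zero hK hf.1.1 hf.2

lemma integrable (hK : MeasurableSet K) (hμ : μ K ≠ ∞) (hf : MemL2On μ K f) : Integrable f μ := by
  refine memLp_one_iff_integrable.1 ⟨hf.1.1, (hf.eLpNorm_one_le hK).trans_lt ?_⟩
  exact ENNReal.mul_lt_top hf.1.2 (ENNReal.rpow_lt_top_of_nonneg (by norm_num) hμ)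

end MemL2On

lemma polarization (z w : ℂ) : z * conj w = (1 / 4) * (((‖z + w‖ ^ 2 : ℝ) : ℂ) -
    ((‖z - w‖ ^ 2 : ℝ) : ℂ) + Complex.I * ((‖z + Complex.I * w‖ ^ 2 : ℝ) : ℂ) -
    Complex.I * ((‖z - Complex.I * w‖ ^ 2 : ℝ) : ℂ)) := by
  simp only [← Complex.normSq_eq_norm_sq, ← Complex.mul_conj, map_add, map_sub, map_mul,
    Complex.conj_I]
  ring_nf
  simp only [Complex.I_sq]
  ring

lemma integral_mul_conj_eq {X : Type*} [MeasurableSpace X] (ρ : Measure X) {f g : X → ℂ}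
    (hf : MemLp f 2 ρ) (hg : MemLp g 2 ρ) :
    ∫ x, f x * conj (g x) ∂ρ = (1 / 4) * (∫ x, ((‖(f + g) x‖ ^ 2 : ℝ) : ℂ) ∂ρ -
      ∫ x, ((‖(f - g) x‖ ^ 2 : ℝ) : ℂ) ∂ρ +
      Complex.I * ∫ x, ((‖(f + Complex.I • g) x‖ ^ 2 : ℝ) : ℂ) ∂ρ -
      Complex.I * ∫ x, ((‖(f - Complex.I • g) x‖ ^ 2 : ℝ) : ℂ) ∂ρ) := by
  have hi : ∀ {k : X → ℂ}, MemLp k 2 ρ → Integrable (fun x => ((‖k x‖ ^ 2 : ℝ) : ℂ)) ρ :=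
    fun hk => ((memLp_two_iff_integrable_sq_norm hk.1).1 hk).ofReal
  have h1 := hi (hf.add hg)
  have h2 := hi (hf.sub hg)
  have h3 := hi (hf.add (hg.const_smul Complex.I))
  have h4 := hi (hf.sub (hg.const_smul Complex.I))
  have h12 : Integrable (fun x => ((‖(f + g) x‖ ^ 2 : ℝ) : ℂ) - ((‖(f - g) x‖ ^ 2 : ℝ) : ℂ)) ρ :=
    h1.sub h2
  have h3' := h3.const_mul Complex.I
  have h123 : Integrable (fun x => ((‖(f + g) x‖ ^ 2 : ℝ) : ℂ) - ((‖(f - g) x‖ ^ 2 : ℝ) : ℂ) +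
      Complex.I * ((‖(f + Complex.I • g) x‖ ^ 2 : ℝ) : ℂ)) ρ := h12.add h3'
  rw [← integral_const_mul, ← integral_const_mul, ← integral_sub h1 h2, ← integral_add h12 h3',
    ← integral_sub h123 (h4.const_mul _), ← integral_const_mul]
  refine integral_congr_ae (Eventually.of_forall fun x => ?_)
  exact polarization (f x) (g x)

variable {G : Type*} [CommGroup G] [TopologicalSpace G] [IsTopologicalGroup G]
  [T2Space G] [LocallyCompactSpace G] [MeasurableSpace G] [BorelSpace G]
  (μ : Measure G) [μ.IsHaarMeasure] [μ.Regular]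

/-- Approximation in `L²` by continuous functions supported in a fixed compact set. -/
lemma exists_seq_tendsto_of_memL2On {K : Set G} (hK : IsCompact K) {f : G → ℂ}
    (hf : MemL2On μ K f) :
    ∃ S : Set G, IsCompact S ∧ K ⊆ S ∧ ∃ g : ℕ → C_c(G, ℂ), (∀ n, MemL2On μ S (g n)) ∧
      Tendsto (fun n => eLpNorm (f - ⇑(g n)) 2 μ) atTop (𝓝 0) := by
  obtain ⟨κ, hκ1, -, hκc, hκ⟩ := exists_continuous_one_zero_of_isCompact hK isClosed_empty
    (Set.disjoint_empty _)
  have hex : ∀ n : ℕ, ∃ g : C_c(G, ℂ), eLpNorm (f - ⇑g) 2 μ ≤ (n : ℝ≥0∞)⁻¹ := fun n =>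
    exists_compactlySupported_eLpNorm_sub_le μ (by simp) hf.memLp (by simp)
  choose g hg using hex
  have hS : ∀ n, HasCompactSupport fun x => (κ x : ℂ) * g n x := fun n =>
    HasCompactSupport.intro hκc.isCompact fun x hx => by
      rw [image_eq_zero_of_notMem_tsupport hx, Complex.ofReal_zero, zero_mul]
  let k : ℕ → C_c(G, ℂ) := fun n =>
    ⟨⟨fun x => (κ x : ℂ) * g n x, (Complex.continuous_ofReal.comp κ.continuous).mul
      (g n).continuous⟩, hS n⟩
  refine ⟨tsupport κ, hκc.isCompact, fun x hx => subset_tsupport _ ?_, k, fun n =>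
    ⟨memLp_of_compactlySupported μ _ _, Eventually.of_forall fun x hx => ?_⟩, ?_⟩
  · rw [Function.mem_support, hκ1 hx]
    exact one_ne_zero
  · change (κ x : ℂ) * g n x = 0
    rw [image_eq_zero_of_notMem_tsupport hx, Complex.ofReal_zero, zero_mul]
  · refine tendsto_of_tendsto_of_tendsto_of_le_of_le tendsto_const_nhds
      ENNReal.tendsto_inv_nat_nhds_zero (fun n => zero_le) fun n => (?_ : _ ≤ _).trans (hg n)
    refine eLpNorm_mono_ae ?_
    filter_upwards [hf.ae_eq_zero] with x hx
    -- The cutoff is harmless because `f` vanishes off `K`.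
    have h1 : f x = (κ x : ℂ) * f x := by
      by_cases hxK : x ∈ K
      · rw [hκ1 hxK, Pi.one_apply, Complex.ofReal_one, one_mul]
      · rw [hx hxK, mul_zero]
    change ‖f x - (κ x : ℂ) * g n x‖ ≤ ‖f x - g n x‖
    rw [h1, ← mul_sub, norm_mul, ← h1, Complex.norm_real, Real.norm_of_nonneg (hκ x).1]
    exact mul_le_of_le_one_left (norm_nonneg _) (hκ x).2

section Plancherel

variable [MeasurableSpace (PontryaginDual G)] [BorelSpace (PontryaginDual G)]
  (ν : Measure (PontryaginDual G))

lemma tendsto_scalarFourier {S : Set G} (hS : IsCompact S) {f : G → ℂ} {g : ℕ → C_c(G, ℂ)}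
    (hf : MemL2On μ S f) (hg : ∀ n, MemL2On μ S (g n))
    (h : Tendsto (fun n => eLpNorm (f - ⇑(g n)) 2 μ) atTop (𝓝 0)) (ξ : PontryaginDual G) :
    Tendsto (fun n => scalarFourier μ (g n) ξ) atTop (𝓝 (scalarFourier μ f ξ)) := by
  have hμS : μ S ≠ ∞ := hS.measure_lt_top.ne
  rw [tendsto_iff_edist_tendsto_0]
  have h2 : Tendsto (fun n => eLpNorm (f - ⇑(g n)) 2 μ * μ S ^ (1 / 2 : ℝ)) atTop (𝓝 0) := by
    have := ENNReal.Tendsto.mul_const (b := μ S ^ (1 / 2 : ℝ)) h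
      (Or.inr (ENNReal.rpow_ne_top_of_nonneg (by norm_num) hμS))
    rwa [zero_mul] at this
  refine tendsto_of_tendsto_of_tendsto_of_le_of_le tendsto_const_nhds h2 (fun n => zero_le)
    fun n => ?_
  rw [edist_comm, edist_eq_enorm_sub, ← scalarFourier_sub μ (hf.integrable hS.measurableSet hμS)
    ((hg n).integrable hS.measurableSet hμS)]
  exact (enorm_scalarFourier_le μ _ ξ).trans ((hf.sub (hg n)).eLpNorm_one_le hS.measurableSet)

lemma aestronglyMeasurable_scalarFourier {K : Set G} (hK : IsCompact K) {f : G → ℂ}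
    (hf : MemL2On μ K f) : AEStronglyMeasurable (scalarFourier μ f) ν := by
  obtain ⟨S, hS, hKS, g, hg, hlim⟩ := exists_seq_tendsto_of_memL2On μ hK hf
  exact aestronglyMeasurable_of_tendsto_ae atTop
    (fun n => (continuous_scalarFourier μ (g n)).measurable.aestronglyMeasurable)
    (Eventually.of_forall (tendsto_scalarFourier μ hS (hf.mono hKS) hg hlim))

-- `c` is a constant for which the Plancherel theorem holds on `C_c(G)`.
variable {c : ℝ≥0}
  (hc : ∀ g : C_c(G, ℂ), eLpNorm (scalarFourier μ g) 2 ν = c * eLpNorm g 2 μ)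
include hc

lemma eLpNorm_scalarFourier_le {K : Set G} (hK : IsCompact K) {f : G → ℂ} (hf : MemL2On μ K f) :
    eLpNorm (scalarFourier μ f) 2 ν ≤ c * eLpNorm f 2 μ := by
  obtain ⟨S, hS, hKS, g, hg, hlim⟩ := exists_seq_tendsto_of_memL2On μ hK hf
  refine (Lp.eLpNorm_lim_le_liminf_eLpNorm
    (fun n => (continuous_scalarFourier μ (g n)).measurable.aestronglyMeasurable) _
    (Eventually.of_forall (tendsto_scalarFourier μ hS (hf.mono hKS) hg hlim))).trans ?_
  have hb : Tendsto (fun n => c * (eLpNorm f 2 μ + eLpNorm (f - ⇑(g n)) 2 μ)) atTop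
      (𝓝 (c * (eLpNorm f 2 μ + 0))) :=
    ENNReal.Tendsto.const_mul (tendsto_const_nhds.add hlim) (Or.inr ENNReal.coe_ne_top)
  rw [add_zero] at hb
  rw [← hb.liminf_eq]
  refine liminf_le_liminf (Eventually.of_forall fun n => ?_)
  rw [hc]
  gcongr
  have : (g n : G → ℂ) = f - (f - ⇑(g n)) := by abel
  conv_lhs => rw [this]
  exact eLpNorm_sub_le hf.memLp.1 (hf.memLp.1.sub (hg n).memLp.1) (by norm_num)

/-- The Plancherel theorem for square integrable functions supported in a compact set. -/
lemma eLpNorm_scalarFourier {K : Set G} (hK : IsCompact K) {f : G → ℂ} (hf : MemL2On μ K f) :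
    eLpNorm (scalarFourier μ f) 2 ν = c * eLpNorm f 2 μ := by
  refine le_antisymm (eLpNorm_scalarFourier_le μ ν hc hK hf) ?_
  obtain ⟨S, hS, hKS, g, hg, hlim⟩ := exists_seq_tendsto_of_memL2On μ hK hf
  have hμS : μ S ≠ ∞ := hS.measure_lt_top.ne
  have hfS := hf.mono hKS
  have hb : Tendsto (fun n => eLpNorm (scalarFourier μ f) 2 ν +
      (c * eLpNorm (f - ⇑(g n)) 2 μ + c * eLpNorm (f - ⇑(g n)) 2 μ)) atTop
      (𝓝 (eLpNorm (scalarFourier μ f) 2 ν + (c * 0 + c * 0))) :=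
    tendsto_const_nhds.add ((ENNReal.Tendsto.const_mul hlim (Or.inr ENNReal.coe_ne_top)).add
      (ENNReal.Tendsto.const_mul hlim (Or.inr ENNReal.coe_ne_top)))
  rw [mul_zero, add_zero, add_zero] at hb
  refine ge_of_tendsto hb (Eventually.of_forall fun n => ?_)
  have hsub : scalarFourier μ (f - ⇑(g n)) = scalarFourier μ f - scalarFourier μ (g n) :=
    funext (scalarFourier_sub μ (hfS.integrable hS.measurableSet hμS)
      ((hg n).integrable hS.measurableSet hμS))
  have h1 : eLpNorm f 2 μ ≤ eLpNorm (g n) 2 μ + eLpNorm (f - ⇑(g n)) 2 μ := by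
    have : f = ⇑(g n) + (f - ⇑(g n)) := by abel
    conv_lhs => rw [this]
    exact eLpNorm_add_le (hg n).memLp.1 (hf.memLp.1.sub (hg n).memLp.1) (by norm_num)
  have h2 : eLpNorm (scalarFourier μ (g n)) 2 ν ≤ eLpNorm (scalarFourier μ f) 2 ν +
      c * eLpNorm (f - ⇑(g n)) 2 μ := by
    have : scalarFourier μ (g n) = scalarFourier μ f - scalarFourier μ (f - ⇑(g n)) := by
      rw [hsub]; abel
    rw [this]
    refine (eLpNorm_sub_le (aestronglyMeasurable_scalarFourier μ ν hK hf)
      (aestronglyMeasurable_scalarFourier μ ν hS (hfS.sub (hg n))) (by norm_num)).trans ?_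
    gcongr
    exact eLpNorm_scalarFourier_le μ ν hc hS (hfS.sub (hg n))
  calc c * eLpNorm f 2 μ ≤ c * (eLpNorm (g n) 2 μ + eLpNorm (f - ⇑(g n)) 2 μ) := by gcongr
    _ = eLpNorm (scalarFourier μ (g n)) 2 ν + c * eLpNorm (f - ⇑(g n)) 2 μ := by
        rw [mul_add, hc]
    _ ≤ _ := by
        rw [← add_assoc]
        gcongr

lemma memLp_scalarFourier {K : Set G} (hK : IsCompact K) {f : G → ℂ} (hf : MemL2On μ K f) :
    MemLp (scalarFourier μ f) 2 ν :=
  ⟨aestronglyMeasurable_scalarFourier μ ν hK hf, by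
    rw [eLpNorm_scalarFourier μ ν hc hK hf]
    exact ENNReal.mul_lt_top ENNReal.coe_lt_top hf.memLp.2⟩

lemma integral_norm_sq_scalarFourier {K : Set G} (hK : IsCompact K) {f : G → ℂ}
    (hf : MemL2On μ K f) :
    ∫ ξ, ((‖scalarFourier μ f ξ‖ ^ 2 : ℝ) : ℂ) ∂ν =
      ((c ^ 2 : ℝ≥0) : ℂ) * ∫ x, ((‖f x‖ ^ 2 : ℝ) : ℂ) ∂μ := by
  have key : ∀ {X : Type _} [MeasurableSpace X] (ρ : Measure X) {k : X → ℂ}, MemLp k 2 ρ →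
      ∫ x, ‖k x‖ ^ 2 ∂ρ = (eLpNorm k 2 ρ ^ 2).toReal := by
    intro X _ ρ k hk
    rw [eLpNorm_two_sq, integral_eq_lintegral_of_nonneg_ae (Eventually.of_forall fun _ => sq_nonneg _)
      (hk.1.norm.pow 2)]
    congr 1
    refine lintegral_congr fun x => ?_
    rw [ENNReal.ofReal_pow (norm_nonneg _), ofReal_norm]
  rw [integral_complex_ofReal, integral_complex_ofReal, key ν (memLp_scalarFourier μ ν hc hK hf),
    key μ hf.memLp, eLpNorm_scalarFourier μ ν hc hK hf, mul_pow, ENNReal.toReal_mul]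
  simp

/-- Parseval's identity for square integrable functions supported in a compact set. -/
lemma integral_scalarFourier_mul_conj {K : Set G} (hK : IsCompact K) {f g : G → ℂ}
    (hf : MemL2On μ K f) (hg : MemL2On μ K g) :
    ∫ ξ, scalarFourier μ f ξ * conj (scalarFourier μ g ξ) ∂ν =
      ((c ^ 2 : ℝ≥0) : ℂ) * ∫ x, f x * conj (g x) ∂μ := by
  have hfi := hf.integrable hK.measurableSet hK.measure_lt_top.ne
  have hgi := hg.integrable hK.measurableSet hK.measure_lt_top.ne
  have hgI := (hg.smul Complex.I).integrable hK.measurableSet hK.measure_lt_top.ne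
  have e0 : scalarFourier μ (Complex.I • g) = Complex.I • scalarFourier μ g :=
    funext (scalarFourier_smul μ Complex.I g)
  have e1 : scalarFourier μ (f + g) = scalarFourier μ f + scalarFourier μ g :=
    funext (scalarFourier_add μ hfi hgi)
  have e2 : scalarFourier μ (f - g) = scalarFourier μ f - scalarFourier μ g :=
    funext (scalarFourier_sub μ hfi hgi)
  have e3 : scalarFourier μ (f + Complex.I • g) =
      scalarFourier μ f + scalarFourier μ (Complex.I • g) :=
    funext (scalarFourier_add μ hfi hgI)
  have e4 : scalarFourier μ (f - Complex.I • g) =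
      scalarFourier μ f - scalarFourier μ (Complex.I • g) :=
    funext (scalarFourier_sub μ hfi hgI)
  rw [integral_mul_conj_eq ν (memLp_scalarFourier μ ν hc hK hf) (memLp_scalarFourier μ ν hc hK hg),
    integral_mul_conj_eq μ hf.memLp hg.memLp, ← e0, ← e1, ← e2, ← e3, ← e4,
    integral_norm_sq_scalarFourier μ ν hc hK (hf.add hg),
    integral_norm_sq_scalarFourier μ ν hc hK (hf.sub hg),
    integral_norm_sq_scalarFourier μ ν hc hK (hf.add (hg.smul Complex.I)),
    integral_norm_sq_scalarFourier μ ν hc hK (hf.sub (hg.smul Complex.I))]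
  ring

end Plancherel

end

/-! ### Quadratic forms controlled by a compact family of matrices -/

section

lemma continuous_quadForm {J : ℕ} (Q : Matrix (Fin J) (Fin J) ℂ) : Continuous (quadForm Q) := by
  unfold quadForm
  fun_prop

lemma quadForm_smul {J : ℕ} (Q : Matrix (Fin J) (Fin J) ℂ) (t : ℝ)
    (v : EuclideanSpace ℂ (Fin J)) : quadForm Q ((t : ℂ) • v) = ((t ^ 2 : ℝ) : ℂ) * quadForm Q v := by
  simp only [quadForm, Finset.mul_sum, PiLp.smul_apply, smul_eq_mul, map_mul, Complex.conj_ofReal,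
    Complex.ofReal_pow]
  refine Finset.sum_congr rfl fun j _ => Finset.sum_congr rfl fun k _ => ?_
  ring

lemma continuousOn_norm_toEuclideanLin_apply {X : Type*} [TopologicalSpace X] {I J : ℕ}
    {m : X → Matrix (Fin I) (Fin J) ℂ} {𝒦 : Set X} (hm : ContinuousOn m 𝒦) :
    ContinuousOn (fun q : X × EuclideanSpace ℂ (Fin J) => ‖Matrix.toEuclideanLin (m q.1) q.2‖)
      (𝒦 ×ˢ Set.univ) := by
  have h : ContinuousOn (fun q : X × EuclideanSpace ℂ (Fin J) => m q.1 *ᵥ WithLp.ofLp q.2)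
      (𝒦 ×ˢ Set.univ) := by
    refine continuousOn_pi.2 fun i => ?_
    simp only [Matrix.mulVec, dotProduct]
    refine continuousOn_finsetSum _ fun j _ => ContinuousOn.mul ?_ ?_
    · have h1 : ContinuousOn (fun ξ => m ξ i j) 𝒦 :=
        continuousOn_pi.1 (continuousOn_pi.1 hm i) j
      exact h1.comp continuousOn_fst fun q hq => hq.1
    · exact Continuous.continuousOn (by fun_prop)
  exact ((PiLp.continuous_toLp 2 _).comp_continuousOn h).norm

/-- The unit sphere case of `exists_norm_quadForm_le`, for an arbitrary continuous function `h` in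
place of the norms of the images under a family of matrices. -/
lemma exists_norm_quadForm_le_of_norm_eq_one {X : Type*} [TopologicalSpace X] {J : ℕ}
    {h : X × EuclideanSpace ℂ (Fin J) → ℝ} {𝒦 : Set X} (h𝒦 : IsCompact 𝒦)
    (hh : ContinuousOn h (𝒦 ×ˢ Set.univ)) (hpos : ∀ q, 0 ≤ h q) (Q : Matrix (Fin J) (Fin J) ℂ)
    (hQ : ∀ ξ ∈ 𝒦, ∀ v, h (ξ, v) = 0 → quadForm Q v = 0) {δ : ℝ} (hδ : 0 < δ) :
    ∃ C : ℝ, 0 ≤ C ∧ ∀ ξ ∈ 𝒦, ∀ v, ‖v‖ = 1 → ‖quadForm Q v‖ ≤ δ + C * h (ξ, v) ^ 2 := by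
  have hS : IsCompact (Metric.sphere (0 : EuclideanSpace ℂ (Fin J)) 1) := isCompact_sphere _ _
  obtain ⟨M, hM⟩ := hS.exists_bound_of_continuousOn (continuous_quadForm Q).continuousOn
  -- On the compact set `D` of unit vectors with large `Q`, the function `h` is bounded below.
  obtain ⟨D, hD⟩ : ∃ D : Set (X × EuclideanSpace ℂ (Fin J)), D =
      (𝒦 ×ˢ Metric.sphere 0 1) ∩ {q | δ ≤ ‖quadForm Q q.2‖} := ⟨_, rfl⟩
  have hDc : IsCompact D := hD ▸ (h𝒦.prod hS).inter_right
    (isClosed_le continuous_const ((continuous_quadForm Q).comp continuous_snd).norm)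
  have hmem : ∀ ξ v, (ξ, v) ∈ D ↔ (ξ ∈ 𝒦 ∧ ‖v‖ = 1) ∧ δ ≤ ‖quadForm Q v‖ := fun ξ v => by
    simp [hD]
  have hcont : ContinuousOn h D :=
    hh.mono fun q hq => ⟨((hmem q.1 q.2).1 hq).1.1, Set.mem_univ _⟩
  rcases D.eq_empty_or_nonempty with hE | hne
  · refine ⟨0, le_rfl, fun ξ hξ v hv => ?_⟩
    have : (ξ, v) ∉ D := by rw [hE]; exact Set.notMem_empty _
    have h2 : ¬ δ ≤ ‖quadForm Q v‖ := fun h => this ((hmem ξ v).2 ⟨⟨hξ, hv⟩, h⟩)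
    linarith
  · obtain ⟨⟨ξ₀, v₀⟩, hq, hmin⟩ := hDc.exists_isMinOn hne hcont
    obtain ⟨⟨hξ₀, hv₀⟩, hδ₀⟩ := (hmem ξ₀ v₀).1 hq
    have ha : 0 < h (ξ₀, v₀) := by
      refine (hpos _).lt_of_ne fun h0 => ?_
      rw [hQ ξ₀ hξ₀ v₀ h0.symm, norm_zero] at hδ₀
      linarith
    have hM0 : 0 ≤ M := (norm_nonneg _).trans (hM v₀ (by simpa using hv₀))
    refine ⟨M / h (ξ₀, v₀) ^ 2, by positivity, fun ξ hξ v hv => ?_⟩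
    by_cases hδv : δ ≤ ‖quadForm Q v‖
    · have h4 : h (ξ₀, v₀) ≤ h (ξ, v) := hmin ((hmem ξ v).2 ⟨⟨hξ, hv⟩, hδv⟩)
      have h5 : M ≤ M / h (ξ₀, v₀) ^ 2 * h (ξ, v) ^ 2 := by
        rw [div_mul_eq_mul_div, le_div_iff₀ (by positivity)]
        gcongr
      have h6 := hM v (by simpa using hv)
      linarith
    · have : 0 ≤ M / h (ξ₀, v₀) ^ 2 * h (ξ, v) ^ 2 := by positivity
      linarith

/-- The compactness inequality behind compensated compactness: a quadratic form that vanishes on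
the kernels of a continuous compact family of matrices is controlled by these matrices up to an
arbitrarily small multiple of the norm. -/
lemma exists_norm_quadForm_le {X : Type*} [TopologicalSpace X] {I J : ℕ}
    {m : X → Matrix (Fin I) (Fin J) ℂ} {𝒦 : Set X} (h𝒦 : IsCompact 𝒦) (hm : ContinuousOn m 𝒦)
    (Q : Matrix (Fin J) (Fin J) ℂ)
    (hQ : ∀ ξ ∈ 𝒦, ∀ v, Matrix.toEuclideanLin (m ξ) v = 0 → quadForm Q v = 0)
    {δ : ℝ} (hδ : 0 < δ) :
    ∃ C : ℝ, 0 ≤ C ∧ ∀ ξ ∈ 𝒦, ∀ v, ‖quadForm Q v‖ ≤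
      δ * ‖v‖ ^ 2 + C * ‖Matrix.toEuclideanLin (m ξ) v‖ ^ 2 := by
  obtain ⟨C, hC, h⟩ := exists_norm_quadForm_le_of_norm_eq_one h𝒦
    (continuousOn_norm_toEuclideanLin_apply hm) (fun _ => norm_nonneg _) Q
    (fun ξ hξ v hv => hQ ξ hξ v (norm_eq_zero.1 hv)) hδ
  refine ⟨C, hC, fun ξ hξ v => ?_⟩
  rcases eq_or_ne v 0 with rfl | hv
  · simp [quadForm]
  have hvn : 0 < ‖v‖ := norm_pos_iff.2 hv
  obtain ⟨w, hw1, hvw⟩ : ∃ w, ‖w‖ = 1 ∧ v = ((‖v‖ : ℝ) : ℂ) • w := by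
    refine ⟨((‖v‖⁻¹ : ℝ) : ℂ) • v, ?_, ?_⟩
    · rw [norm_smul, Complex.norm_real, norm_inv, norm_norm, inv_mul_cancel₀ hvn.ne']
    · rw [smul_smul, ← Complex.ofReal_mul, mul_inv_cancel₀ hvn.ne', Complex.ofReal_one, one_smul]
  have h6 := mul_le_mul_of_nonneg_left (h ξ hξ w hw1) (sq_nonneg ‖v‖)
  have h7 : ‖quadForm Q v‖ = ‖v‖ ^ 2 * ‖quadForm Q w‖ := by
    conv_lhs => rw [hvw]
    rw [quadForm_smul, norm_mul, Complex.norm_real, Real.norm_of_nonneg (sq_nonneg _)]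
  have h8 : ‖Matrix.toEuclideanLin (m ξ) v‖ = ‖v‖ * ‖Matrix.toEuclideanLin (m ξ) w‖ := by
    conv_lhs => rw [hvw]
    rw [map_smul, norm_smul, Complex.norm_real, norm_norm]
  rw [h7, h8]
  linarith

/-- A precompact sequence in `L²` that converges pointwise converges in `L²`. -/
lemma PrecompactInL2.tendsto_eLpNorm {X : Type*} [MeasurableSpace X] {ν : Measure X} {I : ℕ}
    {F : ℕ → X → EuclideanSpace ℂ (Fin I)} (hF : PrecompactInL2 ν F)
    {F₀ : X → EuclideanSpace ℂ (Fin I)} (h : ∀ x, Tendsto (fun n => F n x) atTop (𝓝 (F₀ x))) :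
    Tendsto (fun n => eLpNorm (F n - F₀) 2 ν) atTop (𝓝 0) := by
  obtain ⟨hL, hc⟩ := hF
  refine tendsto_of_subseq_tendsto fun ns hns => ?_
  obtain ⟨a, -, φ, hφ, ha⟩ := hc.tendsto_subseq
    (x := fun k => ((hL (ns k)).toLp (F (ns k)) : L2 ν I)) fun k => subset_closure ⟨ns k, rfl⟩
  obtain ⟨θ, hθm, hθ⟩ := (tendstoInMeasure_of_tendsto_Lp ha).exists_seq_tendsto_ae
  have hall : ∀ᵐ x ∂ν, ∀ k, ((hL (ns k)).toLp (F (ns k)) : L2 ν I) x = F (ns k) x :=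
    ae_all_iff.2 fun k => MemLp.coeFn_toLp _
  have haF : (a : X → EuclideanSpace ℂ (Fin I)) =ᵐ[ν] F₀ := by
    filter_upwards [hθ, hall] with x h1 h2
    refine tendsto_nhds_unique h1 ?_
    simp only [Function.comp_apply, h2]
    exact (h x).comp (hns.comp (hφ.tendsto_atTop.comp hθm.tendsto_atTop))
  refine ⟨φ, ?_⟩
  have h3 := (Lp.tendsto_Lp_iff_tendsto_eLpNorm' _ _).1 ha
  refine h3.congr fun k => eLpNorm_congr_ae ?_
  filter_upwards [haF, hall] with x h1 h2
  simp only [Function.comp_apply, Pi.sub_apply, h1, h2]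

lemma enorm_sq_eq_sum {J : ℕ} (v : EuclideanSpace ℂ (Fin J)) : ‖v‖ₑ ^ 2 = ∑ j, ‖v j‖ₑ ^ 2 := by
  simp only [← ofReal_norm, ← ENNReal.ofReal_pow (norm_nonneg _)]
  rw [EuclideanSpace.norm_sq_eq, ENNReal.ofReal_sum_of_nonneg fun j _ => sq_nonneg _]

lemma eLpNorm_sq_eq_sum {X : Type*} [MeasurableSpace X] (ν : Measure X) {J : ℕ}
    {f : X → EuclideanSpace ℂ (Fin J)} (hf : ∀ j, AEStronglyMeasurable (fun x => f x j) ν) :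
    eLpNorm f 2 ν ^ 2 = ∑ j, eLpNorm (fun x => f x j) 2 ν ^ 2 := by
  simp only [eLpNorm_two_sq, enorm_sq_eq_sum]
  exact lintegral_finsetSum' _ fun j _ => (hf j).enorm.pow_const 2

/-- Quadratic forms converge to zero along sequences that are bounded in `L²`, converge to zero
pointwise and boundedly on a set `Ξ` of finite measure, and are controlled off `Ξ` by functions
`N n` that converge to zero in `L²`, up to an arbitrarily small multiple of the norm. -/
lemma tendsto_integral_quadForm {X : Type*} [MeasurableSpace X] {ν : Measure X} {Ξ : Set X}
    (hΞ : MeasurableSet Ξ) (hνΞ : ν Ξ ≠ ∞) {I J : ℕ} (Q : Matrix (Fin J) (Fin J) ℂ)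
    {w : ℕ → X → EuclideanSpace ℂ (Fin J)} {N : ℕ → X → EuclideanSpace ℂ (Fin I)}
    (hw : ∀ n, AEStronglyMeasurable (w n) ν) {B : ℝ≥0∞} (hB : B ≠ ∞)
    (hwB : ∀ n, eLpNorm (w n) 2 ν ^ 2 ≤ B)
    {b : ℝ} (hb : ∀ n x, ‖w n x‖ ≤ b) (hlim : ∀ x, Tendsto (fun n => w n x) atTop (𝓝 0))
    (hN : Tendsto (fun n => eLpNorm (N n) 2 (ν.restrict Ξᶜ)) atTop (𝓝 0))
    (hQ : ∀ δ : ℝ, 0 < δ → ∃ C : ℝ, 0 ≤ C ∧ ∀ n, ∀ x ∈ Ξᶜ,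
      ‖quadForm Q (w n x)‖ ≤ δ * ‖w n x‖ ^ 2 + C * ‖N n x‖ ^ 2) :
    Tendsto (fun n => ∫ x, quadForm Q (w n x) ∂ν) atTop (𝓝 0) := by
  have hq0 : quadForm Q 0 = 0 := by simp [quadForm]
  have hqw : ∀ n, AEStronglyMeasurable (fun x => quadForm Q (w n x)) ν := fun n =>
    (continuous_quadForm Q).comp_aestronglyMeasurable (hw n)
  obtain ⟨M, hM⟩ := (isCompact_closedBall (0 : EuclideanSpace ℂ (Fin J)) b).exists_bound_of_continuousOn
    (continuous_quadForm Q).continuousOn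
  have hΞlim : Tendsto (fun n => ∫⁻ x in Ξ, ‖quadForm Q (w n x)‖ₑ ∂ν) atTop (𝓝 0) := by
    have := tendsto_lintegral_of_dominated_convergence' (μ := ν.restrict Ξ)
      (F := fun n x => ‖quadForm Q (w n x)‖ₑ) (f := fun _ => 0) (fun _ => ENNReal.ofReal M)
      (fun n => (hqw n).restrict.enorm) (fun n => Eventually.of_forall fun x => ?_) ?_
      (Eventually.of_forall fun x => ?_)
    · simpa using this
    · change ‖quadForm Q (w n x)‖ₑ ≤ ENNReal.ofReal M
      rw [← ofReal_norm]
      exact ENNReal.ofReal_le_ofReal (hM _ (mem_closedBall_zero_iff.2 (hb n x)))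
    · rw [lintegral_const, Measure.restrict_apply_univ]
      exact ENNReal.mul_ne_top ENNReal.ofReal_ne_top hνΞ
    · have := (((continuous_quadForm Q).tendsto 0).comp (hlim x)).enorm
      simpa [hq0] using this
  have hkey : Tendsto (fun n => ∫⁻ x, ‖quadForm Q (w n x)‖ₑ ∂ν) atTop (𝓝 0) := by
    rw [ENNReal.tendsto_nhds_zero]
    intro ε hε
    obtain ⟨δ, hδ, hδB⟩ : ∃ δ : ℝ, 0 < δ ∧ ENNReal.ofReal δ * B ≤ ε / 2 := by
      obtain ⟨r, hr, hrB⟩ := ENNReal.exists_nnreal_pos_mul_lt hB (ENNReal.half_pos hε.ne').ne'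
      exact ⟨r, hr, by simpa using hrB.le⟩
    obtain ⟨C, hC, hQC⟩ := hQ δ hδ
    have h2 : Tendsto (fun n => ∫⁻ x in Ξ, ‖quadForm Q (w n x)‖ₑ ∂ν +
        ENNReal.ofReal C * eLpNorm (N n) 2 (ν.restrict Ξᶜ) ^ 2) atTop (𝓝 0) := by
      have := hΞlim.add (ENNReal.Tendsto.const_mul (a := ENNReal.ofReal C) (ENNReal.Tendsto.pow (n := 2) hN)
        (Or.inr ENNReal.ofReal_ne_top))
      simpa using this
    filter_upwards [(ENNReal.tendsto_nhds_zero.1 h2) (ε / 2) (ENNReal.half_pos hε.ne')] with n hn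
    have h3 : ∫⁻ x in Ξᶜ, ‖quadForm Q (w n x)‖ₑ ∂ν ≤ ENNReal.ofReal δ * B +
        ENNReal.ofReal C * eLpNorm (N n) 2 (ν.restrict Ξᶜ) ^ 2 := by
      calc ∫⁻ x in Ξᶜ, ‖quadForm Q (w n x)‖ₑ ∂ν
          ≤ ∫⁻ x in Ξᶜ, (ENNReal.ofReal δ * ‖w n x‖ₑ ^ 2 + ENNReal.ofReal C * ‖N n x‖ₑ ^ 2) ∂ν := by
            refine setLIntegral_mono' hΞ.compl fun x hx => ?_
            rw [← ofReal_norm, ← ofReal_norm, ← ofReal_norm, ← ENNReal.ofReal_pow (norm_nonneg _),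
              ← ENNReal.ofReal_pow (norm_nonneg _), ← ENNReal.ofReal_mul hδ.le,
              ← ENNReal.ofReal_mul hC, ← ENNReal.ofReal_add (by positivity) (by positivity)]
            exact ENNReal.ofReal_le_ofReal (hQC n x hx)
        _ = ENNReal.ofReal δ * eLpNorm (w n) 2 (ν.restrict Ξᶜ) ^ 2 +
            ENNReal.ofReal C * eLpNorm (N n) 2 (ν.restrict Ξᶜ) ^ 2 := by
            rw [lintegral_add_left' (((hw n).restrict.enorm.pow_const 2).const_mul _),
              lintegral_const_mul' _ _ ENNReal.ofReal_ne_top,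
              lintegral_const_mul' _ _ ENNReal.ofReal_ne_top, eLpNorm_two_sq, eLpNorm_two_sq]
        _ ≤ _ := by
            gcongr
            refine le_trans ?_ (hwB n)
            gcongr
            exact Measure.restrict_le_self
    rw [← lintegral_add_compl _ hΞ]
    calc _ ≤ ∫⁻ x in Ξ, ‖quadForm Q (w n x)‖ₑ ∂ν + (ENNReal.ofReal δ * B +
          ENNReal.ofReal C * eLpNorm (N n) 2 (ν.restrict Ξᶜ) ^ 2) := by gcongr
      _ = ENNReal.ofReal δ * B + (∫⁻ x in Ξ, ‖quadForm Q (w n x)‖ₑ ∂ν +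
          ENNReal.ofReal C * eLpNorm (N n) 2 (ν.restrict Ξᶜ) ^ 2) := by ring
      _ ≤ ε / 2 + ε / 2 := add_le_add hδB hn
      _ = ε := ENNReal.add_halves ε
  rw [tendsto_iff_edist_tendsto_0]
  refine tendsto_of_tendsto_of_tendsto_of_le_of_le tendsto_const_nhds hkey (fun n => zero_le)
    fun n => ?_
  rw [edist_zero_right]
  exact enorm_integral_le_lintegral_enorm _

end

/-! ### Compensated compactness -/

section

lemma quadForm_eq_inner {J : ℕ} (Q : Matrix (Fin J) (Fin J) ℂ) (v : EuclideanSpace ℂ (Fin J)) :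
    quadForm Q v = inner ℂ v (Matrix.toEuclideanLin Qᵀ v) := by
  rw [PiLp.inner_apply, quadForm, Finset.sum_comm]
  refine Finset.sum_congr rfl fun k _ => ?_
  rw [Matrix.toLpLin_apply, RCLike.inner_apply]
  simp only [Matrix.mulVec, dotProduct, Finset.sum_mul, Matrix.transpose_apply]

/-- The integral of a quadratic form is itself a quadratic form on `L²`, given by a bounded
operator. -/
lemma exists_integral_quadForm_eq_inner {X : Type*} [MeasurableSpace X] (μ : Measure X) {J : ℕ}
    (Q : Matrix (Fin J) (Fin J) ℂ) :
    ∃ A : L2 μ J →L[ℂ] L2 μ J, ∀ u : L2 μ J, ∫ g, quadForm Q (u g) ∂μ = inner ℂ u (A u) := by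
  refine ⟨(Matrix.toEuclideanLin Qᵀ).toContinuousLinearMap.compLpL 2 μ, fun u => ?_⟩
  rw [L2.inner_def]
  refine integral_congr_ae ?_
  filter_upwards [ContinuousLinearMap.coeFn_compLpL
    (Matrix.toEuclideanLin Qᵀ).toContinuousLinearMap u] with x hx
  rw [hx, quadForm_eq_inner]
  rfl

/-- Along a weakly convergent sequence, convergence of a quadratic form reduces to the case of a
weak limit that vanishes. -/
lemma tendsto_inner_apply_of_sub {E : Type*} [NormedAddCommGroup E] [InnerProductSpace ℂ E]
    [CompleteSpace E] (A : E →L[ℂ] E) {u : ℕ → E} {u₀ : E}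
    (hu : ∀ φ, Tendsto (fun n => inner ℂ φ (u n - u₀)) atTop (𝓝 0))
    (h : Tendsto (fun n => inner ℂ (u n - u₀) (A (u n - u₀))) atTop (𝓝 0)) :
    Tendsto (fun n => inner ℂ (u n) (A (u n))) atTop (𝓝 (inner ℂ u₀ (A u₀))) := by
  have h1 : Tendsto (fun n => inner ℂ (u n - u₀) (A u₀)) atTop (𝓝 0) := by
    have := (Complex.continuous_conj.tendsto 0).comp (hu (A u₀))
    simpa [Function.comp_def] using this
  have h2 : Tendsto (fun n => inner ℂ u₀ (A (u n - u₀))) atTop (𝓝 0) := by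
    simpa only [ContinuousLinearMap.adjoint_inner_left] using hu (ContinuousLinearMap.adjoint A u₀)
  have h3 := ((h.add h1).add h2).add_const (inner ℂ u₀ (A u₀))
  rw [add_zero, add_zero, zero_add] at h3
  refine h3.congr fun n => ?_
  obtain ⟨v, hv⟩ : ∃ v, u n = v + u₀ := ⟨u n - u₀, by simp⟩
  rw [hv, add_sub_cancel_right, map_add, inner_add_left, inner_add_right, inner_add_right]
  ring

/-- Weakly convergent sequences are bounded. -/
lemma exists_norm_le_of_tendsto_inner {E : Type*} [NormedAddCommGroup E] [InnerProductSpace ℂ E]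
    [CompleteSpace E] {v : ℕ → E} (hv : ∀ φ, Tendsto (fun n => inner ℂ φ (v n)) atTop (𝓝 0)) :
    ∃ R : ℝ, ∀ n, ‖v n‖ ≤ R := by
  obtain ⟨R, hR⟩ := banach_steinhaus (g := fun n => innerSL ℂ (v n)) fun φ => by
    obtain ⟨C, hC⟩ := (Metric.isBounded_range_of_tendsto _ (hv φ)).exists_norm_le
    refine ⟨C, fun n => ?_⟩
    rw [innerSL_apply_apply, norm_inner_symm]
    exact hC _ ⟨n, rfl⟩
  exact ⟨R, fun n => by simpa using hR n⟩

/-- A weak limit of functions that vanish off `K` vanishes off `K`. -/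
lemma ae_eq_zero_of_tendsto_inner {X : Type*} [MeasurableSpace X] {μ : Measure X} {J : ℕ}
    {K : Set X} (hK : MeasurableSet K) {u : ℕ → L2 μ J} {u₀ : L2 μ J}
    (hu : ∀ n, ∀ᵐ g ∂μ, g ∉ K → u n g = 0)
    (hlim : ∀ φ : L2 μ J, Tendsto (fun n => inner ℂ φ (u n)) atTop (𝓝 (inner ℂ φ u₀))) :
    ∀ᵐ g ∂μ, g ∉ K → u₀ g = 0 := by
  have hm : MemLp (Kᶜ.indicator u₀) 2 μ := (Lp.memLp u₀).indicator hK.compl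
  have h0 : ∀ n, inner ℂ (hm.toLp _) (u n) = 0 := fun n => by
    rw [L2.inner_def]
    refine integral_eq_zero_of_ae ?_
    filter_upwards [hm.coeFn_toLp, hu n] with g h1 h2
    rw [h1]
    by_cases hg : g ∈ K
    · rw [Set.indicator_of_notMem (Set.notMem_compl_iff.2 hg), inner_zero_left, Pi.zero_apply]
    · rw [h2 hg, inner_zero_right, Pi.zero_apply]
  have h1 : inner ℂ (hm.toLp _) u₀ = 0 :=
    tendsto_nhds_unique (hlim _) (by simpa only [h0] using tendsto_const_nhds)
  have h2 : inner ℂ (hm.toLp _) (hm.toLp _ : L2 μ J) = inner ℂ (hm.toLp _) u₀ := by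
    rw [L2.inner_def, L2.inner_def]
    refine integral_congr_ae ?_
    filter_upwards [hm.coeFn_toLp] with g h1
    rw [h1]
    by_cases hg : g ∈ K
    · rw [Set.indicator_of_notMem (Set.notMem_compl_iff.2 hg), inner_zero_left, inner_zero_left]
    · rw [Set.indicator_of_mem (show g ∈ Kᶜ from hg)]
  rw [h1, inner_self_eq_zero] at h2
  filter_upwards [hm.coeFn_toLp, Lp.coeFn_zero (EuclideanSpace ℂ (Fin J)) 2 μ] with g h3 h4 hg
  rw [h2, h4, Set.indicator_of_mem (show g ∈ Kᶜ from hg)] at h3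
  exact h3.symm

lemma memL2On_apply {X : Type*} [MeasurableSpace X] {μ : Measure X} {J : ℕ}
    {K : Set X} {v : L2 μ J} (hv : ∀ᵐ g ∂μ, g ∉ K → v g = 0) (j : Fin J) :
    MemL2On μ K (fun g => v g j) where
  memLp := (EuclideanSpace.proj (𝕜 := ℂ) j).comp_memLp v
  ae_eq_zero := hv.mono fun g h hg => by rw [h hg]; rfl

lemma integrable_of_ae_eq_zero {X : Type*} [MeasurableSpace X] {μ : Measure X} {J : ℕ}
    {K : Set X} (hK : MeasurableSet K) (hμK : μ K ≠ ∞) {v : L2 μ J}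
    (hv : ∀ᵐ g ∂μ, g ∉ K → v g = 0) : Integrable v μ :=
  Integrable.of_eval_piLp fun j => (memL2On_apply hv j).integrable hK hμK

variable {G : Type*} [CommGroup G] [TopologicalSpace G] [IsTopologicalGroup G]
  [T2Space G] [LocallyCompactSpace G] [MeasurableSpace G] [BorelSpace G]
  (μ : Measure G) [μ.IsHaarMeasure] [μ.Regular]

lemma integrable_conj_smul {J : ℕ} {v : G → EuclideanSpace ℂ (Fin J)} (hv : Integrable v μ)
    (ξ : PontryaginDual G) : Integrable (fun g => conj (ξ g : ℂ) • v g) μ := by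
  refine hv.mono ?_ (Eventually.of_forall fun g => ?_)
  · exact (Complex.continuous_conj.comp (continuous_dual_apply ξ)).aestronglyMeasurable.smul hv.1
  · rw [norm_smul, RCLike.norm_conj, norm_dual_apply, one_mul]

lemma fourier_apply {J : ℕ} {v : G → EuclideanSpace ℂ (Fin J)} (hv : Integrable v μ)
    (ξ : PontryaginDual G) (j : Fin J) :
    fourier μ v ξ j = scalarFourier μ (fun g => v g j) ξ :=
  ((EuclideanSpace.proj (𝕜 := ℂ) j).integral_comp_comm (integrable_conj_smul μ hv ξ)).symm

/-- On functions supported in a fixed compact set, weak convergence in `L²` gives pointwise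
convergence of the Fourier transforms. -/
lemma tendsto_fourier {J : ℕ} {K : Set G} (hK : IsCompact K) {v : ℕ → L2 μ J}
    (hvK : ∀ n, ∀ᵐ g ∂μ, g ∉ K → v n g = 0)
    (hv : ∀ φ, Tendsto (fun n => inner ℂ φ (v n)) atTop (𝓝 0)) (ξ : PontryaginDual G) :
    Tendsto (fun n => fourier μ (v n) ξ) atTop (𝓝 0) := by
  have hKm := hK.measurableSet
  have hμK : μ K ≠ ∞ := hK.measure_lt_top.ne
  have : IsFiniteMeasure (μ.restrict K) := ⟨by simpa using hμK.lt_top⟩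
  suffices h : ∀ j, Tendsto (fun n => fourier μ (v n) ξ j) atTop (𝓝 0) from
    ((PiLp.continuous_toLp 2 _).tendsto 0).comp (tendsto_pi_nhds.2 h)
  intro j
  have hm : MemLp (K.indicator fun g => (ξ g : ℂ) • EuclideanSpace.single j (1 : ℂ)) 2 μ := by
    rw [memLp_indicator_iff_restrict hKm]
    refine MemLp.of_bound ?_ 1 (Eventually.of_forall fun g => ?_)
    · exact ((continuous_dual_apply ξ).smul continuous_const).aestronglyMeasurable
    · rw [norm_smul, norm_dual_apply, PiLp.norm_single, norm_one, one_mul]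
  refine (hv (hm.toLp _)).congr fun n => ?_
  rw [fourier_apply μ (integrable_of_ae_eq_zero hKm hμK (hvK n)), L2.inner_def]
  refine integral_congr_ae ?_
  filter_upwards [hm.coeFn_toLp, hvK n] with g h1 h2
  rw [h1]
  by_cases hg : g ∈ K
  · rw [Set.indicator_of_mem hg, inner_smul_left, EuclideanSpace.inner_single_left, map_one,
      one_mul]
  · rw [Set.indicator_of_notMem hg, inner_zero_left, h2 hg]
    simp

/-- On functions supported in a fixed compact set, the Fourier transform is bounded from `L²` to
the bounded functions. -/
lemma exists_norm_fourier_le {J : ℕ} {K : Set G} (hK : IsCompact K) :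
    ∃ L : ℝ, 0 ≤ L ∧ ∀ v : L2 μ J, (∀ᵐ g ∂μ, g ∉ K → v g = 0) → ∀ ξ,
      ‖fourier μ v ξ‖ ≤ L * ‖v‖ := by
  have hKm := hK.measurableSet
  have hμK : μ K ≠ ∞ := hK.measure_lt_top.ne
  obtain ⟨κ, hκ⟩ : ∃ κ : ℝ≥0, (κ : ℝ≥0∞) = μ K ^ (1 / 2 : ℝ) :=
    ⟨_, ENNReal.coe_toNNReal (ENNReal.rpow_ne_top_of_nonneg (by norm_num) hμK)⟩
  refine ⟨κ, κ.coe_nonneg, fun v hv ξ => ?_⟩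
  have h1 : ‖fourier μ v ξ‖ₑ ≤ ENNReal.ofReal (κ * ‖v‖) := by
    calc ‖fourier μ v ξ‖ₑ ≤ ∫⁻ g, ‖conj (ξ g : ℂ) • v g‖ₑ ∂μ := enorm_integral_le_lintegral_enorm _
      _ = eLpNorm v 1 μ := by
        rw [eLpNorm_one_eq_lintegral_enorm]
        refine lintegral_congr fun g => ?_
        rw [← ofReal_norm, ← ofReal_norm, norm_smul, RCLike.norm_conj, norm_dual_apply, one_mul]
      _ ≤ eLpNorm v 2 μ * μ K ^ (1 / 2 : ℝ) :=
        eLpNorm_one_le_of_ae_eq_zero hKm (Lp.aestronglyMeasurable v) hv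
      _ = ENNReal.ofReal (κ * ‖v‖) := by
        rw [← hκ, ← Lp.enorm_def, ← ofReal_norm, ENNReal.ofReal_mul κ.coe_nonneg, ENNReal.ofReal_coe_nnreal,
          mul_comm]
  rw [← ofReal_norm] at h1
  exact (ENNReal.ofReal_le_ofReal_iff (mul_nonneg κ.coe_nonneg (norm_nonneg _))).1 h1

lemma integral_quadForm {X : Type*} [MeasurableSpace X] (ρ : Measure X) {J : ℕ}
    (Q : Matrix (Fin J) (Fin J) ℂ) {f : X → EuclideanSpace ℂ (Fin J)}
    (hf : ∀ j, MemLp (fun x => f x j) 2 ρ) :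
    ∫ x, quadForm Q (f x) ∂ρ = ∑ j, ∑ k, Q j k * ∫ x, f x j * conj (f x k) ∂ρ := by
  have hi : ∀ j k, Integrable (fun x => Q j k * (f x j * conj (f x k))) ρ := fun j k =>
    ((hf j).integrable_mul (hf k).star).const_mul _
  simp only [quadForm, mul_assoc]
  rw [integral_finsetSum _ fun j _ => integrable_finsetSum _ fun k _ => hi j k]
  refine Finset.sum_congr rfl fun j _ => ?_
  rw [integral_finsetSum _ fun k _ => hi j k]
  exact Finset.sum_congr rfl fun k _ => integral_const_mul _ _

variable [MeasurableSpace (PontryaginDual G)] [BorelSpace (PontryaginDual G)]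
  (ν : Measure (PontryaginDual G))

lemma memLp_fourier_apply {c : ℝ≥0}
    (hc : ∀ g : C_c(G, ℂ), eLpNorm (scalarFourier μ g) 2 ν = c * eLpNorm g 2 μ)
    {J : ℕ} {K : Set G} (hK : IsCompact K) {v : L2 μ J} (hv : ∀ᵐ g ∂μ, g ∉ K → v g = 0)
    (j : Fin J) : MemLp (fun ξ => fourier μ v ξ j) 2 ν := by
  simp only [fourier_apply μ (integrable_of_ae_eq_zero hK.measurableSet hK.measure_lt_top.ne hv)]
  exact memLp_scalarFourier μ ν hc hK (memL2On_apply hv j)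

/-- Plancherel's formula for vector-valued functions. -/
lemma eLpNorm_fourier {c : ℝ≥0}
    (hc : ∀ g : C_c(G, ℂ), eLpNorm (scalarFourier μ g) 2 ν = c * eLpNorm g 2 μ)
    {J : ℕ} {K : Set G} (hK : IsCompact K) {v : L2 μ J} (hv : ∀ᵐ g ∂μ, g ∉ K → v g = 0) :
    eLpNorm (fourier μ v) 2 ν ^ 2 = (c * eLpNorm v 2 μ) ^ 2 := by
  rw [eLpNorm_sq_eq_sum ν fun j => (memLp_fourier_apply μ ν hc hK hv j).1, mul_pow,
    eLpNorm_sq_eq_sum μ fun j => (memL2On_apply hv j).memLp.1, Finset.mul_sum]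
  refine Finset.sum_congr rfl fun j _ => ?_
  rw [← mul_pow, ← eLpNorm_scalarFourier μ ν hc hK (memL2On_apply hv j)]
  simp only [fourier_apply μ (integrable_of_ae_eq_zero hK.measurableSet hK.measure_lt_top.ne hv)]

/-- Plancherel's formula for quadratic forms. -/
lemma integral_quadForm_fourier {c : ℝ≥0}
    (hc : ∀ g : C_c(G, ℂ), eLpNorm (scalarFourier μ g) 2 ν = c * eLpNorm g 2 μ)
    {J : ℕ} (Q : Matrix (Fin J) (Fin J) ℂ) {K : Set G} (hK : IsCompact K) {v : L2 μ J}
    (hv : ∀ᵐ g ∂μ, g ∉ K → v g = 0) :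
    ∫ ξ, quadForm Q (fourier μ v ξ) ∂ν = ((c ^ 2 : ℝ≥0) : ℂ) * ∫ g, quadForm Q (v g) ∂μ := by
  rw [integral_quadForm ν Q (memLp_fourier_apply μ ν hc hK hv),
    integral_quadForm μ Q fun j => (memL2On_apply hv j).memLp]
  simp only [Finset.mul_sum,
    fourier_apply μ (integrable_of_ae_eq_zero hK.measurableSet hK.measure_lt_top.ne hv)]
  refine Finset.sum_congr rfl fun j _ => Finset.sum_congr rfl fun k _ => ?_
  rw [integral_scalarFourier_mul_conj μ ν hc hK (memL2On_apply hv j) (memL2On_apply hv k)]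
  ring

/-- Compensated compactness for a weak limit that vanishes: the frequencies in `Ξ` contribute
nothing in the limit since the Fourier transforms converge pointwise and boundedly, and off `Ξ` the
form is controlled by the multiplier. -/
lemma tendsto_integral_quadForm_of_weak_zero [ν.IsHaarMeasure] [ν.Regular] {I J : ℕ}
    (Q : Matrix (Fin J) (Fin J) ℂ) {K : Set G} (hK : IsCompact K) {v : ℕ → L2 μ J}
    (hvK : ∀ n, ∀ᵐ g ∂μ, g ∉ K → v n g = 0)
    (hv : ∀ φ, Tendsto (fun n => inner ℂ φ (v n)) atTop (𝓝 0))
    {Ξ : Set (PontryaginDual G)} (hΞ : IsCompact Ξ)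
    {N : ℕ → PontryaginDual G → EuclideanSpace ℂ (Fin I)}
    (hN : Tendsto (fun n => eLpNorm (N n) 2 (ν.restrict Ξᶜ)) atTop (𝓝 0))
    (hQ : ∀ δ : ℝ, 0 < δ → ∃ C : ℝ, 0 ≤ C ∧ ∀ n, ∀ ξ ∈ Ξᶜ, ‖quadForm Q (fourier μ (v n) ξ)‖ ≤
      δ * ‖fourier μ (v n) ξ‖ ^ 2 + C * ‖N n ξ‖ ^ 2) :
    Tendsto (fun n => ∫ g, quadForm Q (v n g) ∂μ) atTop (𝓝 0) := by
  obtain ⟨c, hc0, hc⟩ := exists_eLpNorm_scalarFourier_compactlySupported μ ν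
  obtain ⟨R, hR⟩ := exists_norm_le_of_tendsto_inner hv
  obtain ⟨L, hL, hLv⟩ := exists_norm_fourier_le μ (J := J) hK
  have hlim := tendsto_integral_quadForm (ν := ν) hΞ.measurableSet hΞ.measure_lt_top.ne Q
    (w := fun n => fourier μ (v n)) (N := N) (B := (c * ENNReal.ofReal R) ^ 2) (b := L * R)
    (fun n => (MemLp.of_eval_piLp (memLp_fourier_apply μ ν hc hK (hvK n))).1)
    (ENNReal.pow_ne_top (ENNReal.mul_ne_top ENNReal.coe_ne_top ENNReal.ofReal_ne_top))
    (fun n => ?_) (fun n ξ => ?_) (tendsto_fourier μ hK hvK hv) hN hQ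
  · have hc2 : ((c ^ 2 : ℝ≥0) : ℂ) ≠ 0 := by simpa using hc0
    have := hlim.const_mul (((c ^ 2 : ℝ≥0) : ℂ)⁻¹)
    rw [mul_zero] at this
    refine this.congr fun n => ?_
    rw [integral_quadForm_fourier μ ν hc Q hK (hvK n), inv_mul_cancel_left₀ hc2]
  · rw [eLpNorm_fourier μ ν hc hK (hvK n), ← Lp.enorm_def, ← ofReal_norm]
    gcongr
    exact hR n
  · exact (hLv _ (hvK n) ξ).trans (mul_le_mul_of_nonneg_left (hR n) hL)

end

end LCA

end

theorem theorem3p5 {G : Type*} [CommGroup G] [TopologicalSpace G] [IsTopologicalGroup G]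
    [T2Space G] [LocallyCompactSpace G] [MeasurableSpace G] [BorelSpace G]
    [MeasurableSpace (PontryaginDual G)] [BorelSpace (PontryaginDual G)]
    (μ : Measure G) [μ.IsHaarMeasure] [μ.Regular]
    (ν : Measure (PontryaginDual G)) [ν.IsHaarMeasure] [ν.Regular]
    (I J : ℕ)
    -- the operator `T : L²(G; ℂ^J) → H^{-s}(G; ℂ^I)` and its multiplier `m`
    (γ : PontryaginDual G → ℝ≥0) (_hγ : Measurable γ) (s : ℝ) (_hs : 0 ≤ s)
    (T : LCA.L2 μ J →L[ℂ] LCA.HNeg ν γ s I)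
    (m : PontryaginDual G → Matrix (Fin I) (Fin J) ℂ)
    (_hT : LCA.IsMultiplier μ ν T m)
    -- the quadratic polynomial
    (Q : Matrix (Fin J) (Fin J) ℂ) (hQ : Q.IsHermitian)
    -- (i) weak convergence in `L²_c`
    (u : ℕ → LCA.L2 μ J) (u₀ : LCA.L2 μ J) (hu : LCA.WeaklyConvergesL2c μ u u₀)
    -- (ii) the end of the dual group retracts nicely onto a compact set
    (Ξ 𝒦 : Set (PontryaginDual G)) (hΞ : IsCompact Ξ) (h1Ξ : 1 ∈ Ξ)
    (h𝒦 : IsCompact 𝒦) (h1𝒦 : 1 ∉ 𝒦) (hm : ContinuousOn m 𝒦)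
    (Φ : PontryaginDual G → PontryaginDual G) (hΦ : ContinuousOn Φ Ξᶜ) (hΦ𝒦 : Φ '' Ξᶜ = 𝒦)
    (hpre : LCA.PrecompactInL2 (ν.restrict Ξᶜ)
      fun n ξ => Matrix.toEuclideanLin (m (Φ ξ)) (LCA.fourier μ (u n) ξ))
    -- (iii) `Q` vanishes on the cone
    (hcone : ∀ v ∈ LCA.cone m, LCA.quadForm Q v = 0) :
    Tendsto (fun n => ∫ g, LCA.quadForm Q (u n g) ∂μ) atTop
      (𝓝 (∫ g, LCA.quadForm Q (u₀ g) ∂μ)) := by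
  obtain ⟨⟨K, hK, huK⟩, hlim⟩ := hu
  have hu₀K := LCA.ae_eq_zero_of_tendsto_inner hK.measurableSet huK hlim
  have hvK : ∀ n, ∀ᵐ g ∂μ, g ∉ K → (u n - u₀) g = 0 := fun n => by
    filter_upwards [huK n, hu₀K, Lp.coeFn_sub (u n) u₀] with g h1 h2 h3 hg
    rw [h3, Pi.sub_apply, h1 hg, h2 hg, sub_zero]
  have hv : ∀ φ : LCA.L2 μ J, Tendsto (fun n => inner ℂ φ (u n - u₀)) atTop (𝓝 0) := fun φ => by
    simpa only [inner_sub_right, sub_self] using (hlim φ).sub_const (inner ℂ φ u₀)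
  have hint : ∀ {v : LCA.L2 μ J}, (∀ᵐ g ∂μ, g ∉ K → v g = 0) → Integrable v μ :=
    LCA.integrable_of_ae_eq_zero hK.measurableSet hK.measure_lt_top.ne
  have hsub : ∀ n ξ, LCA.fourier μ (u n - u₀) ξ = LCA.fourier μ (u n) ξ - LCA.fourier μ u₀ ξ :=
    fun n ξ => by
      unfold LCA.fourier
      rw [← integral_sub (LCA.integrable_conj_smul μ (hint (huK n)) ξ)
        (LCA.integrable_conj_smul μ (hint hu₀K) ξ)]
      refine integral_congr_ae ?_
      filter_upwards [Lp.coeFn_sub (u n) u₀] with g hg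
      rw [hg, Pi.sub_apply, smul_sub]
  have hmem : ∀ ξ ∈ Ξᶜ, Φ ξ ∈ 𝒦 := fun ξ hξ => hΦ𝒦 ▸ Set.mem_image_of_mem Φ hξ
  -- The images of `û n` converge in `L²` off `Ξ`: they are precompact and converge pointwise.
  have hN : Tendsto (fun n => eLpNorm (fun ξ => Matrix.toEuclideanLin (m (Φ ξ))
      (LCA.fourier μ (u n - u₀ : LCA.L2 μ J) ξ)) 2 (ν.restrict Ξᶜ)) atTop (𝓝 0) := by
    have h := hpre.tendsto_eLpNorm
      (F₀ := fun ξ => Matrix.toEuclideanLin (m (Φ ξ)) (LCA.fourier μ u₀ ξ)) fun ξ => by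
        have h1 := (LCA.tendsto_fourier μ hK hvK hv ξ).add_const (LCA.fourier μ u₀ ξ)
        simp only [hsub, sub_add_cancel, zero_add] at h1
        exact ((LinearMap.continuous_of_finiteDimensional
          (Matrix.toEuclideanLin (m (Φ ξ)))).tendsto _).comp h1
    refine h.congr fun n => ?_
    congr 1
    funext ξ
    rw [hsub, map_sub]
    rfl
  obtain ⟨A, hA⟩ := LCA.exists_integral_quadForm_eq_inner μ Q
  have h0 := LCA.tendsto_integral_quadForm_of_weak_zero μ ν Q hK hvK hv hΞ hN fun δ hδ => by
    obtain ⟨C, hC, h⟩ := LCA.exists_norm_quadForm_le h𝒦 hm Q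
      (fun ξ hξ v hvξ => hcone v ⟨ξ, fun h => h1𝒦 (h ▸ hξ), hvξ⟩) hδ
    exact ⟨C, hC, fun n ξ hξ => h _ (hmem ξ hξ) _⟩
  -- In terms of `A`, the limit for `u n - u₀` gives the one for `u n`.
  simp only [hA] at h0 ⊢
  exact LCA.tendsto_inner_apply_of_sub A hv h0
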